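/- A \emph{non-deterministic Mealy machine} is a tuple $M=(S,s_0,\Gamma,\Sigma,T)$ with a finite set of states $S$, a start state $s_0\in S$, finite input and output alphabets $\Gamma$ and $\Sigma$ (either of which may in general contain the empty letter $\epsilon$), and a transition function $T:S\times\Gamma\to\mathcal P(S\times\Sigma)$. A computation of $M$ on an input word $x\in\Gamma^*$ starts in $s_0$, follows transitions that read $x$, and generates the word $y\in\Sigma^*$ of the letters output by these transitions. A \emph{census requirement} is a function $c:\Sigma\setminus\{\epsilon\}\to\mathbb N$; a word $y\in\Sigma^*$ \emph{meets} $c$ if every letter $b\in\Sigma\setminus\{\epsilon\}$ occurs exactly $c(b)$ times in $y$. The parameterized problem \textsc{var-GWMM} (variety Given Word Mealy Machine) is: given a non-deterministic Mealy machine $M=(S,s_0,\Gamma,\Sigma,T)$, a word $x\in\Gamma^*$ and a census requirement $c$, whose values are encoded in binary, decide whether there is a computation of $M$ on input $x$ that generates an output $y$ that meets $c$. The parameter is $k=|S|+|\Gamma|+|\Sigma|$. A parameterized problem is in $\mathrm{XP}$ if there are computable functions $f,g:\mathbb N\to\mathbb N$ and an algorithm (a deterministic Turing machine) that solves every instance of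 size $n$ with parameter $k$ in time $f(k)\,n^{g(k)}$. \textbf{Statement.} \textsc{var-GWMM}, with $c$ encoded in binary and restricted to the instances with $\epsilon\notin\Gamma$, is in $\mathrm{XP}$. -/

import Mathlib

/-- A parameterized decision problem: a type of instances, the set of yes-instances, the parameter of
an instance, and the encoding that presents an instance to a machine as a word over a finite alphabet.
The size of an instance is the length of this word. -/
structure ParamProblem where
  Inst : Type
  Yes : Inst → Prop
  param : Inst → ℕ
  Sym : Type
  [finiteSym : Fintype Sym]
  encode : Inst → List Sym

namespace ParamProblem

/-- The size of an instance. -/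
def size (P : ParamProblem) (I : P.Inst) : ℕ := (P.encode I).length

/-- The same problem, on the instances that satisfy `p` only. -/
def restrict (P : ParamProblem) (p : P.Inst → Prop) : ParamProblem :=
  letI := P.finiteSym
  { Inst := {I : P.Inst // p I}
    Yes := fun I => P.Yes I.1
    param := fun I => P.param I.1
    Sym := P.Sym
    encode := fun I => P.encode I.1 }

/-- `P` is in XP: for some computable `f` and `g`, one (deterministic, multi-stack) Turing machine
answers every instance of size `n` and parameter `k` correctly within `f k * n ^ g k` steps. -/
def InXP (P : ParamProblem) : Prop :=
  ∃ f g : ℕ → ℕ, Computable f ∧ Computable g ∧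
    ∃ A : Turing.TM2ComputableAux P.Sym Bool,
      ∀ I : P.Inst, ∃ answer : Bool, (answer = true ↔ P.Yes I) ∧
        Nonempty (Turing.TM2OutputsInTime A.tm
          ((P.encode I).map A.inputAlphabet.symm)
          (some ((Computability.encodeBool answer).map A.outputAlphabet.symm))
          (f (P.param I) * P.size I ^ g (P.param I)))

end ParamProblem

/-- Letters are drawn from a countable supply; `none` is the empty letter `ε`. -/
abbrev Letter : Type := Option ℕ

/-- A nondeterministic Mealy machine `(S, s₀, Γ, Σ, T)` with `T : S × Γ → 𝒫(S × Σ)`. -/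
structure MealyMachine where
  states : Finset ℕ
  start : states
  inputs : Finset Letter
  outputs : Finset Letter
  trans : states × inputs → Finset (states × outputs)

namespace MealyMachine

/-- `M.Run p u y q`: from state `p` there is a sequence of transitions to state `q` whose input letters
are, in order, `u`, and whose output letters are, in order, `y` (either may contain `ε`). -/
inductive Run (M : MealyMachine) :
    M.states → List M.inputs → List M.outputs → M.states → Prop
  | nil (p : M.states) : Run M p [] [] p
  | cons {p q r : M.states} {a : M.inputs} {b : M.outputs}
      {u : List M.inputs} {y : List M.outputs} :
      (q, b) ∈ M.trans (p, a) → Run M q u y r → Run M p (a :: u) (b :: y) r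

/-- The word spelled by a sequence of letters: the occurrences of `ε` disappear. -/
def spell {A : Finset Letter} (u : List A) : List ℕ :=
  (u.map Subtype.val).reduceOption

/-- Some computation of `M` on the input word `x` generates the output `y`. -/
def Generates (M : MealyMachine) (x : List M.inputs) (y : List M.outputs) : Prop :=
  ∃ (u : List M.inputs) (q : M.states), spell u = spell x ∧ M.Run M.start u y q

/-- A census requirement: a natural number for every output letter other than `ε`. -/
abbrev Census (M : MealyMachine) : Type := {b : M.outputs // b.1 ≠ none} → ℕ

/-- The word `y` meets the census requirement `c`. -/
def Meets (M : MealyMachine) (y : List M.outputs) (c : M.Census) : Prop :=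
  ∀ b : {b : M.outputs // b.1 ≠ none}, y.count b.1 = c b

end MealyMachine

/-- An instance of the Given Word Mealy Machine problem. -/
structure GWMMInstance where
  machine : MealyMachine
  word : List machine.inputs
  census : machine.Census

namespace GWMMInstance

/-- The alphabet in which instances are written down. -/
inductive Sym : Type
  | bit (b : Bool)
  | eps
  | comma
  | hash
  deriving DecidableEq, Fintype

/-- A natural number in binary (least significant bit first), terminated by a comma. -/
def encodeNat (n : ℕ) : List Sym := n.bits.map Sym.bit ++ [Sym.comma]

/-- A letter: `ε`, or its number in binary, terminated by a comma. -/
def encodeLetter : Letter → List Sym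
  | none => [Sym.eps, Sym.comma]
  | some a => encodeNat a

/-- The elements of a finite set, listed without repetition. -/
def listing {α : Type} [Encodable α] (s : Finset α) : List α :=
  s.sort (Encodable.encode' α ⁻¹'o (· ≤ ·))

/-- A list of items, terminated by a hash. -/
def encodeList {α : Type} (e : α → List Sym) (l : List α) : List Sym :=
  l.flatMap e ++ [Sym.hash]

/-- The graph of the transition function. -/
def transitions (M : MealyMachine) :
    Finset ((M.states × M.inputs) × (M.states × M.outputs)) :=
  Finset.univ.filter fun t => t.2 ∈ M.trans t.1

/-- The description of an instance: the state set, the start state, the two alphabets, the transitions,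
the input word, and the census requirement as the list of all pairs of a letter `b ≠ ε` and the number
`c b`. All numbers, in particular the values of `c`, are in binary. -/
def encode (I : GWMMInstance) : List Sym :=
  encodeList (fun s => encodeNat s) (listing I.machine.states) ++
  encodeNat I.machine.start ++
  encodeList encodeLetter (listing I.machine.inputs) ++
  encodeList encodeLetter (listing I.machine.outputs) ++
  encodeList (fun t => encodeNat t.1.1 ++ encodeLetter t.1.2 ++
    encodeNat t.2.1 ++ encodeLetter t.2.2) (listing (transitions I.machine)) ++
  encodeList (fun a => encodeLetter a.1) I.word ++
  encodeList (fun b => encodeLetter b.1.1 ++ encodeNat (I.census b)) (listing Finset.univ)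

end GWMMInstance

/-- The problem var-GWMM, with the census requirement in binary: given a nondeterministic Mealy machine
`M`, an input word `x` and a census requirement `c`, does some computation of `M` on input `x` generate
an output that meets `c`? The parameter is `|S| + |Γ| + |Σ|`. -/
def varGWMM : ParamProblem where
  Inst := GWMMInstance
  Yes := fun I => ∃ y, I.machine.Generates I.word y ∧ I.machine.Meets y I.census
  param := fun I =>
    I.machine.states.card + I.machine.inputs.card + I.machine.outputs.card
  Sym := GWMMInstance.Sym
  encode := GWMMInstance.encode

/-! Since the empty letter is not an input letter, a computation on the word `x` takes exactly `|x|`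
transitions and outputs at most `|x|` letters. Whether it can still be completed to one that meets
the census depends only on its current state and on how often each output letter has occurred. So
after any prefix of `x` there are at most `|S| * (|x| + 1) ^ |Σ|` configurations to distinguish,
however large the binary census values are. The algorithm reads `x` letter by letter, keeps the
repetition-free list of reachable configurations, and finally asks whether one of them has met every
requirement.

Instead of counting upwards, a configuration stores the binary numbers still needed and decrements
them. An underflow leaves a permanent mark, so a requirement is met exactly when its number has
become zero (`all_dec_iterate`). Correctness is `mem_foldl_stepSet` with `accepts_iff`; the counting
argument is `length_foldl_stepSet_le`, and `repSize_foldl_stepSet_le` turns it into a bound on the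
size of the stored list.

The rest makes this a statement about Turing machines. Structured stack programs are compiled to
multi-stack machines with exact step counts (`Exec.reachesIn`, `outputsInTime`). Data are binary
trees written as prefix codes, and the functions computed in polynomial time on them are closed
under composition, case distinction and list operations. The main loop is a fold whose intermediate
results are not of polynomial size; `foldl_budget` therefore bounds its time by a polynomial in the
input size and in a separate bound on the intermediate results. With the bound from counting
configurations, the whole running time is a fixed power of `n + |S| * (n + 1) ^ |Σ| + 2`, and
`bound_le` brings it into the form `f k * n ^ g k`. -/

/-! ## A structured language for stack machines -/

/-- Structured programs that operate on stacks. -/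
inductive StackCmd {K : Type} (Γ : K → Type) : Type
  /-- Do nothing. -/
  | skip : StackCmd Γ
  /-- Push a letter. -/
  | push (k : K) (a : Γ k) : StackCmd Γ
  /-- Pop a letter, if there is one, and continue depending on the result. -/
  | pop (k : K) (f : Option (Γ k) → StackCmd Γ) : StackCmd Γ
  /-- One program after the other. -/
  | seq (c d : StackCmd Γ) : StackCmd Γ
  /-- Pop a letter and run the program for this letter, until the stack is empty. -/
  | loop (k : K) (f : Γ k → StackCmd Γ) : StackCmd Γ

namespace StackCmd

open Turing

variable {K : Type} {Γ : K → Type}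

/-- The labels of the machine that runs a program. -/
def Lbl : StackCmd Γ → Type
  | skip => Unit
  | push _ _ => Unit
  | pop _ f => Option (Σ o, Lbl (f o))
  | seq c d => Lbl c ⊕ Lbl d
  | loop _ f => Option (Σ a, Lbl (f a))

/-- The label at which a program starts. -/
def entry : (c : StackCmd Γ) → Lbl c
  | skip => ()
  | push _ _ => ()
  | pop _ _ => none
  | seq c _ => Sum.inl (entry c)
  | loop _ _ => none

theorem finite_lbl [∀ k, Finite (Γ k)] (c : StackCmd Γ) : Finite (Lbl c) := by
  induction c with
  | skip => exact inferInstanceAs (Finite Unit)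
  | push _ _ => exact inferInstanceAs (Finite Unit)
  | pop k f ih => exact inferInstanceAs (Finite (Option (Σ o, Lbl (f o))))
  | seq c d h1 h2 => exact inferInstanceAs (Finite (Lbl c ⊕ Lbl d))
  | loop k f ih => exact inferInstanceAs (Finite (Option (Σ o, Lbl (f o))))

variable [DecidableEq K]

/-- The statements of the machine that runs a program, with the labels embedded into a larger
type of labels and with a label at which to continue after the end of the program. -/
def stmts {Λ : Type} : (c : StackCmd Γ) → (Lbl c → Λ) → Λ → Lbl c →
    TM2.Stmt Γ Λ (∀ k, Option (Γ k))
  | skip, _, exit, _ => .goto fun _ => exit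
  | push k a, _, exit, _ => .push k (fun _ => a) (.goto fun _ => exit)
  | pop k f, emb, _, none =>
      .pop k (fun v o => Function.update v k o) (.goto fun v => emb (some ⟨v k, entry (f (v k))⟩))
  | pop _ f, emb, exit, some ⟨o, l⟩ => stmts (f o) (fun l => emb (some ⟨o, l⟩)) exit l
  | seq c d, emb, _, .inl l => stmts c (fun l => emb (.inl l)) (emb (.inr (entry d))) l
  | seq _ d, emb, exit, .inr l => stmts d (fun l => emb (.inr l)) exit l
  | loop k f, emb, exit, none =>
      .pop k (fun v o => Function.update v k o) (.goto fun v =>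
        match v k with
        | none => exit
        | some a => emb (some ⟨a, entry (f a)⟩))
  | loop _ f, emb, _, some ⟨a, l⟩ => stmts (f a) (fun l => emb (some ⟨a, l⟩)) (emb none) l

/-- `Exec c s s' t`: the program `c` transforms the stacks `s` into `s'` in exactly `t` steps. -/
inductive Exec : StackCmd Γ → (∀ k, List (Γ k)) → (∀ k, List (Γ k)) → ℕ → Prop
  | skip (s : ∀ k, List (Γ k)) : Exec skip s s 1
  | push (k : K) (a : Γ k) (s : ∀ k, List (Γ k)) :
      Exec (push k a) s (Function.update s k (a :: s k)) 1
  | pop {k : K} {f : Option (Γ k) → StackCmd Γ} {s s' : ∀ k, List (Γ k)} {t : ℕ} :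
      Exec (f (s k).head?) (Function.update s k (s k).tail) s' t → Exec (pop k f) s s' (t + 1)
  | seq {c d : StackCmd Γ} {s s' s'' : ∀ k, List (Γ k)} {t t' : ℕ} :
      Exec c s s' t → Exec d s' s'' t' → Exec (seq c d) s s'' (t + t')
  | loopNil {k : K} {f : Γ k → StackCmd Γ} {s : ∀ k, List (Γ k)} :
      s k = [] → Exec (loop k f) s s 1
  | loopCons {k : K} {f : Γ k → StackCmd Γ} {s s' s'' : ∀ k, List (Γ k)} {a : Γ k}
      {l : List (Γ k)} {t t' : ℕ} :
      s k = a :: l → Exec (f a) (Function.update s k l) s' t → Exec (loop k f) s' s'' t' →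
      Exec (loop k f) s s'' (t + t' + 1)

/-- In every step, a stack grows by at most one letter. -/
theorem Exec.length_le {c : StackCmd Γ} {s s' : ∀ k, List (Γ k)} {t : ℕ} (h : Exec c s s' t)
    (k : K) : (s' k).length ≤ (s k).length + t := by
  induction h with
  | skip s => omega
  | push j a s =>
    by_cases e : k = j
    · subst e; simp
    · simp [e]
  | @pop j f s s' t h ih =>
    by_cases e : k = j
    · subst e; simp at ih; omega
    · simp [e] at ih; omega
  | seq _ _ h1 h2 => omega
  | loopNil _ => omega
  | @loopCons j f s s' s'' a l t t' hs h1 h2 ih1 ih2 =>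
    by_cases e : k = j
    · subst e; simp at ih1; rw [hs]; simp; omega
    · simp [e] at ih1; omega

/-- `ReachesIn P n c c'`: the machine `P` gets from `c` to `c'` in `n` steps. -/
def ReachesIn {Λ σ : Type} (P : Λ → TM2.Stmt Γ Λ σ) (n : ℕ) (c c' : TM2.Cfg Γ Λ σ) : Prop :=
  (flip bind (TM2.step P))^[n] (some c) = some c'

theorem ReachesIn.trans {Λ σ : Type} {P : Λ → TM2.Stmt Γ Λ σ} {m n : ℕ} {a b c : TM2.Cfg Γ Λ σ}
    (h : ReachesIn P m a b) (h' : ReachesIn P n b c) : ReachesIn P (m + n) a c := by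
  unfold ReachesIn at *
  rw [Nat.add_comm, Function.iterate_add_apply, h, h']

theorem ReachesIn.single {Λ σ : Type} {P : Λ → TM2.Stmt Γ Λ σ} {a b : TM2.Cfg Γ Λ σ}
    (h : TM2.step P a = some b) : ReachesIn P 1 a b := h

theorem step_some {Λ σ : Type} {P : Λ → TM2.Stmt Γ Λ σ} {l : Λ} {q : TM2.Stmt Γ Λ σ}
    (h : P l = q) {v : σ} {s : ∀ k, List (Γ k)} :
    TM2.step P ⟨some l, v, s⟩ = some (TM2.stepAux q v s) := by
  rw [← h]; rfl

/-- This is the shape in which `initList` and `haltList` describe stacks of which only one may be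
nonempty. -/
theorem dite_eq_update (k₀ : K) (l : List (Γ k₀)) :
    (fun k => @dite (List (Γ k)) (k = k₀) (inferInstance) (fun h => by rw [h]; exact l)
      fun _ => []) = Function.update (fun _ => []) k₀ l := by
  funext k
  by_cases e : k = k₀
  · subst e
    simp
  · simp [e]

/-- Induction on the execution. The embedding of labels, the exit label and the local store all have
to vary: a subprogram sits inside a larger label type and exits into its successor. The initial
local store is arbitrary, because the entry for a stack is overwritten by a pop just before it is
read. -/
theorem Exec.reachesIn {Λ : Type} {P : Λ → TM2.Stmt Γ Λ (∀ k, Option (Γ k))} {c : StackCmd Γ}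
    {s s' : ∀ k, List (Γ k)} {t : ℕ} (h : Exec c s s' t) (emb : Lbl c → Λ) (exit : Λ)
    (hP : ∀ l, P (emb l) = stmts c emb exit l) (v : ∀ k, Option (Γ k)) :
    ∃ v', ReachesIn P t ⟨some (emb (entry c)), v, s⟩ ⟨some exit, v', s'⟩ := by
  induction h generalizing exit v with
  | skip s => exact ⟨v, .single (step_some (hP ()))⟩
  | push k a s => exact ⟨v, .single (step_some (hP ()))⟩
  | @pop k f s s' t h ih =>
    obtain ⟨v', h'⟩ := ih (fun l => emb (some ⟨_, l⟩)) exit (fun l => hP (some ⟨_, l⟩))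
      (Function.update v k (s k).head?)
    refine ⟨v', ?_⟩
    rw [Nat.add_comm]
    refine ReachesIn.trans (.single ((step_some (hP none)).trans ?_)) h'
    exact congrArg (fun o => some (TM2.Cfg.mk (some (emb (some ⟨o, entry (f o)⟩))) _ _))
      (Function.update_self k (s k).head? v)
  | @seq c d s s' s'' t t' h1 h2 ih1 ih2 =>
    obtain ⟨v1, h1'⟩ := ih1 (fun l => emb (.inl l)) (emb (.inr (entry d)))
      (fun l => hP (.inl l)) v
    obtain ⟨v2, h2'⟩ := ih2 (fun l => emb (.inr l)) exit (fun l => hP (.inr l)) v1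
    exact ⟨v2, h1'.trans h2'⟩
  | @loopNil k f s hs =>
    refine ⟨Function.update v k none, .single ((step_some (hP none)).trans ?_)⟩
    simp only [stmts, TM2.stepAux, Function.update_self, hs, List.head?_nil, List.tail_nil]
    rw [← hs, Function.update_eq_self]
  | @loopCons k f s s' s'' a l t t' hs h1 h2 ih1 ih2 =>
    obtain ⟨v1, h1'⟩ := ih1 (fun l => emb (some ⟨a, l⟩)) (emb none)
      (fun l => hP (some ⟨a, l⟩)) (Function.update v k (some a))
    obtain ⟨v2, h2'⟩ := ih2 emb exit hP v1
    refine ⟨v2, ?_⟩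
    rw [Nat.add_comm]
    refine ReachesIn.trans (.single ((step_some (hP none)).trans ?_)) (h1'.trans h2')
    simp only [stmts, TM2.stepAux, Function.update_self, hs, List.head?_cons, List.tail_cons]

/-- The machine that runs a program. All its stacks have finite alphabets. -/
noncomputable def toFinTM2 [Fintype K] [∀ k, Fintype (Γ k)] (k₀ k₁ : K) (c : StackCmd Γ) :
    FinTM2 where
  K := K
  k₀ := k₀
  k₁ := k₁
  Γ := Γ
  Λ := Option (Lbl c)
  main := some (entry c)
  ΛFin := haveI := finite_lbl c; Fintype.ofFinite _
  σ := ∀ k, Option (Γ k)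
  initialState := fun _ => none
  m := fun l => match l with
    | some l => stmts c some none l
    | none => .load (fun _ _ => none) .halt

/-- The additional step is spent at the exit label `none`, which resets the local store before
halting, as `haltList` demands. -/
theorem outputsInTime [Fintype K] [∀ k, Fintype (Γ k)] {k₀ k₁ : K} {c : StackCmd Γ}
    {l : List (Γ k₀)} {l' : List (Γ k₁)} {t T : ℕ}
    (h : Exec c (Function.update (fun _ => []) k₀ l) (Function.update (fun _ => []) k₁ l') t)
    (hT : t + 1 ≤ T) :
    Nonempty (TM2OutputsInTime (toFinTM2 k₀ k₁ c) l (some l') T) := by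
  obtain ⟨v, hv⟩ := h.reachesIn (P := (toFinTM2 k₀ k₁ c).m) some none (fun _ => rfl)
    (fun _ => none)
  have e : ReachesIn (toFinTM2 k₀ k₁ c).m (t + 1) _ _ :=
    hv.trans (.single (b := ⟨none, fun _ => none, Function.update (fun _ => []) k₁ l'⟩) rfl)
  have i0 : initList (toFinTM2 k₀ k₁ c) l = ⟨some (some (entry c)), fun _ => none,
      Function.update (fun _ => []) k₀ l⟩ := by
    exact congrArg (TM2.Cfg.mk (some (some (entry c))) fun _ => none) (dite_eq_update k₀ l)
  have i1 : haltList (toFinTM2 k₀ k₁ c) l' = ⟨none, fun _ => none,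
      Function.update (fun _ => []) k₁ l'⟩ := by
    exact congrArg (TM2.Cfg.mk none fun _ => none) (dite_eq_update k₁ l')
  refine ⟨⟨⟨t + 1, ?_⟩, hT⟩⟩
  refine Eq.trans (congrArg _ (congrArg some i0)) (Eq.trans ?_ (congrArg some i1.symm))
  exact e

end StackCmd

/-! ## Binary trees on a stack -/

/-- The data on which programs operate: binary trees. -/
inductive Data : Type
  | nil : Data
  | cons (a b : Data) : Data
  deriving DecidableEq

namespace Data

/-- The word that presents a tree on a stack. It is a prefix code. -/
def enc : Data → List Bool
  | nil => [false]
  | cons a b => true :: (enc a ++ enc b)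

/-- The size of a tree. -/
def size : Data → ℕ
  | nil => 1
  | cons a b => size a + size b + 1

@[simp] theorem length_enc (d : Data) : d.enc.length = d.size := by
  induction d with
  | nil => rfl
  | cons a b ha hb => simp [enc, size, ha, hb]

theorem size_pos (d : Data) : 1 ≤ d.size := by cases d <;> simp [size]

/-- A code word determines where it ends. The arbitrary remainders are what the induction needs,
since the code of the first subtree is followed by that of the second. -/
theorem enc_append_inj {a b : Data} {l l' : List Bool} (h : a.enc ++ l = b.enc ++ l') :
    a = b ∧ l = l' := by
  induction a generalizing b l l' with
  | nil => cases b <;> simp_all [enc]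
  | cons a a' ih ih' =>
    cases b with
    | nil => simp [enc] at h
    | cons b b' =>
      simp only [enc, List.cons_append, List.append_assoc, List.cons.injEq, true_and] at h
      obtain ⟨rfl, h1⟩ := ih h
      obtain ⟨rfl, h2⟩ := ih' h1
      exact ⟨rfl, h2⟩

theorem enc_injective : Function.Injective enc := fun a b h =>
  (enc_append_inj (l := []) (l' := []) (by simp [h])).1

/-- The first component of a pair. -/
def car : Data → Data
  | nil => nil
  | cons a _ => a

/-- The second component of a pair. -/
def cdr : Data → Data
  | nil => nil
  | cons _ b => b

end Data

/-! ### Stacks and their contents -/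

/-- The stacks of the machines. -/
inductive Stk : Type
  | inp | out | main | aux1 | aux2 | cnt | flag
  deriving DecidableEq

instance : Fintype Stk :=
  ⟨{.inp, .out, .main, .aux1, .aux2, .cnt, .flag}, fun k => by cases k <;> decide⟩

/-- The alphabets of the stacks. -/
abbrev StkAlph : Stk → Type
  | .inp => GWMMInstance.Sym
  | .out => Bool
  | .main => Bool
  | .aux1 => Bool
  | .aux2 => Bool
  | .cnt => Bool
  | .flag => Bool

instance : ∀ k, Fintype (StkAlph k)
  | .inp => inferInstanceAs (Fintype GWMMInstance.Sym)
  | .out => inferInstanceAs (Fintype Bool)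
  | .main => inferInstanceAs (Fintype Bool)
  | .aux1 => inferInstanceAs (Fintype Bool)
  | .aux2 => inferInstanceAs (Fintype Bool)
  | .cnt => inferInstanceAs (Fintype Bool)
  | .flag => inferInstanceAs (Fintype Bool)

/-- Contents of the stacks, with an empty output stack. -/
def store (i : List GWMMInstance.Sym) (m q r c f : List Bool) : ∀ k, List (StkAlph k)
  | .inp => i
  | .out => []
  | .main => m
  | .aux1 => q
  | .aux2 => r
  | .cnt => c
  | .flag => f

section
variable (i i' : List GWMMInstance.Sym) (m q r c f l : List Bool)

@[simp] theorem store_inp : store i m q r c f .inp = i := rfl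
@[simp] theorem store_main : store i m q r c f .main = m := rfl
@[simp] theorem store_aux1 : store i m q r c f .aux1 = q := rfl
@[simp] theorem store_aux2 : store i m q r c f .aux2 = r := rfl
@[simp] theorem store_cnt : store i m q r c f .cnt = c := rfl
@[simp] theorem store_flag : store i m q r c f .flag = f := rfl
@[simp] theorem update_store_inp :
    Function.update (store i m q r c f) .inp i' = store i' m q r c f := by
  funext k; cases k <;> rfl
@[simp] theorem update_store_main :
    Function.update (store i m q r c f) .main l = store i l q r c f := by
  funext k; cases k <;> rfl
@[simp] theorem update_store_aux1 :
    Function.update (store i m q r c f) .aux1 l = store i m l r c f := by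
  funext k; cases k <;> rfl
@[simp] theorem update_store_aux2 :
    Function.update (store i m q r c f) .aux2 l = store i m q l c f := by
  funext k; cases k <;> rfl
@[simp] theorem update_store_cnt :
    Function.update (store i m q r c f) .cnt l = store i m q r l f := by
  funext k; cases k <;> rfl
@[simp] theorem update_store_flag :
    Function.update (store i m q r c f) .flag l = store i m q r c l := by
  funext k; cases k <;> rfl

end

/-- Programs on the stacks `Stk`. -/
abbrev Prog : Type := StackCmd StkAlph

/-! ### Rules for bounding the steps of programs -/

namespace Prog

open StackCmd

/-- `Runs c s s' T`: the program `c` transforms the stacks `s` into `s'` in at most `T` steps. -/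
def Runs (c : Prog) (s s' : ∀ k, List (StkAlph k)) (T : ℕ) : Prop := ∃ t ≤ T, Exec c s s' t

section
variable {c d : Prog} {s s' s'' : ∀ k, List (StkAlph k)} {t t' : ℕ} {k : Stk}

theorem Runs.mono (h : Runs c s s' t) (ht : t ≤ t') : Runs c s s' t' :=
  let ⟨n, hn, h⟩ := h
  ⟨n, hn.trans ht, h⟩

theorem runs_skip : Runs .skip s s 1 := ⟨1, le_rfl, .skip s⟩

theorem runs_push {a : StkAlph k} (h : Function.update s k (a :: s k) = s') :
    Runs (.push k a) s s' 1 :=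
  ⟨1, le_rfl, h ▸ .push k a s⟩

theorem runs_push_main {a : Bool} {i : List GWMMInstance.Sym} {m q r c f : List Bool} :
    Runs (.push .main a) (store i m q r c f) (store i (a :: m) q r c f) 1 :=
  runs_push (by simp)

theorem runs_push_aux1 {a : Bool} {i : List GWMMInstance.Sym} {m q r c f : List Bool} :
    Runs (.push .aux1 a) (store i m q r c f) (store i m (a :: q) r c f) 1 :=
  runs_push (by simp)

theorem runs_push_aux2 {a : Bool} {i : List GWMMInstance.Sym} {m q r c f : List Bool} :
    Runs (.push .aux2 a) (store i m q r c f) (store i m q (a :: r) c f) 1 :=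
  runs_push (by simp)

theorem runs_push_cnt {a : Bool} {i : List GWMMInstance.Sym} {m q r c f : List Bool} :
    Runs (.push .cnt a) (store i m q r c f) (store i m q r (a :: c) f) 1 :=
  runs_push (by simp)

theorem runs_push_flag {a : Bool} {i : List GWMMInstance.Sym} {m q r c f : List Bool} :
    Runs (.push .flag a) (store i m q r c f) (store i m q r c (a :: f)) 1 :=
  runs_push (by simp)

theorem Runs.seq (h : Runs c s s' t) (h' : Runs d s' s'' t') : Runs (.seq c d) s s'' (t + t') :=
  let ⟨n, hn, h⟩ := h
  let ⟨n', hn', h'⟩ := h'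
  ⟨n + n', by omega, .seq h h'⟩

theorem runs_pop {f : Option (StkAlph k) → Prog} {a : StkAlph k} {l : List (StkAlph k)}
    (hs : s k = a :: l) (h : Runs (f (some a)) (Function.update s k l) s' t) :
    Runs (.pop k f) s s' (t + 1) :=
  let ⟨n, hn, h⟩ := h
  ⟨n + 1, by omega, .pop (by simpa [hs] using h)⟩

theorem runs_pop_none {f : Option (StkAlph k) → Prog}
    (hs : s k = []) (h : Runs (f none) s s' t) :
    Runs (.pop k f) s s' (t + 1) :=
  let ⟨n, hn, h⟩ := h
  ⟨n + 1, by omega, .pop (by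
    have e : Function.update s k (s k).tail = s := by rw [hs, List.tail_nil, ← hs]; simp
    rw [e, hs]; exact h)⟩

theorem runs_loop_nil {f : StkAlph k → Prog} (hs : s k = []) : Runs (.loop k f) s s 1 :=
  ⟨1, le_rfl, .loopNil hs⟩

theorem runs_loop_cons {f : StkAlph k → Prog} {a : StkAlph k} {l : List (StkAlph k)}
    (hs : s k = a :: l) (h : Runs (f a) (Function.update s k l) s' t)
    (h' : Runs (.loop k f) s' s'' t') : Runs (.loop k f) s s'' (t + t' + 1) :=
  let ⟨n, hn, h⟩ := h
  let ⟨n', hn', h'⟩ := h'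
  ⟨n + n' + 1, by omega, .loopCons hs h h'⟩

end

section
variable {i : List GWMMInstance.Sym} {m q r c f : List Bool} {s s' : ∀ k, List (StkAlph k)}
  {t t' : ℕ}

theorem runs_pop_main {a : Bool} {g : Option Bool → Prog}
    (h : Runs (g (some a)) (store i m q r c f) s t) :
    Runs (.pop .main g) (store i (a :: m) q r c f) s (t + 1) :=
  runs_pop (k := .main) (a := a) (l := m) rfl (by simpa using h)

theorem runs_pop_aux2 {a : Bool} {g : Option Bool → Prog}
    (h : Runs (g (some a)) (store i m q r c f) s t) :
    Runs (.pop .aux2 g) (store i m q (a :: r) c f) s (t + 1) :=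
  runs_pop (k := .aux2) (a := a) (l := r) rfl (by simpa using h)

theorem runs_pop_cnt {a : Bool} {g : Option Bool → Prog}
    (h : Runs (g (some a)) (store i m q r c f) s t) :
    Runs (.pop .cnt g) (store i m q r (a :: c) f) s (t + 1) :=
  runs_pop (k := .cnt) (a := a) (l := c) rfl (by simpa using h)

theorem runs_loop_inp {a : GWMMInstance.Sym} {g : GWMMInstance.Sym → Prog}
    (h : Runs (g a) (store i m q r c f) s t) (h' : Runs (.loop .inp g) s s' t') :
    Runs (.loop .inp g) (store (a :: i) m q r c f) s' (t + t' + 1) :=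
  runs_loop_cons (k := .inp) (a := a) (l := i) rfl (by simpa using h) h'

theorem runs_loop_aux1 {a : Bool} {g : Bool → Prog}
    (h : Runs (g a) (store i m q r c f) s t) (h' : Runs (.loop .aux1 g) s s' t') :
    Runs (.loop .aux1 g) (store i m (a :: q) r c f) s' (t + t' + 1) :=
  runs_loop_cons (k := .aux1) (a := a) (l := q) rfl (by simpa using h) h'

theorem runs_loop_aux2 {a : Bool} {g : Bool → Prog}
    (h : Runs (g a) (store i m q r c f) s t) (h' : Runs (.loop .aux2 g) s s' t') :
    Runs (.loop .aux2 g) (store i m q (a :: r) c f) s' (t + t' + 1) :=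
  runs_loop_cons (k := .aux2) (a := a) (l := r) rfl (by simpa using h) h'

theorem runs_loop_cnt {a : Bool} {g : Bool → Prog}
    (h : Runs (g a) (store i m q r c f) s t) (h' : Runs (.loop .cnt g) s s' t') :
    Runs (.loop .cnt g) (store i m q r (a :: c) f) s' (t + t' + 1) :=
  runs_loop_cons (k := .cnt) (a := a) (l := c) rfl (by simpa using h) h'

theorem runs_loop_flag {a : Bool} {g : Bool → Prog}
    (h : Runs (g a) (store i m q r c f) s t) (h' : Runs (.loop .flag g) s s' t') :
    Runs (.loop .flag g) (store i m q r c (a :: f)) s' (t + t' + 1) :=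
  runs_loop_cons (k := .flag) (a := a) (l := f) rfl (by simpa using h) h'

end

/-! ### Moving, copying and comparing trees -/

/-- The loop of `readTree`. -/
def readLoop (p : Bool → Prog) : Prog :=
  .loop .cnt fun _ => .pop .main fun o => match o with
    | some true => .seq (p true) (.seq (.push .cnt true) (.push .cnt true))
    | some false => p false
    | none => .skip

/-- Remove a tree from the main stack and run `p` on each letter of its word. -/
def readTree (p : Bool → Prog) : Prog := .seq (.push .cnt true) (readLoop p)

section
variable {p : Bool → Prog} {g : List Bool → List Bool × List Bool}

/-- The counter stack holds, in unary, the number of trees still to be read: a leaf uses up one, and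
an inner node replaces one by two. Here `g w` describes the auxiliary stacks after the word `w` has
been read. Each letter costs at most five steps: loop, pop, `p`, and two pushes. -/
theorem runs_readLoop (hp : ∀ a m c w, Runs (p a) (store [] m (g w).1 (g w).2 c [])
      (store [] m (g (w ++ [a])).1 (g (w ++ [a])).2 c []) 1) (d : Data) {m c w : List Bool}
    {s' : ∀ k, List (StkAlph k)} {T : ℕ}
    (h : Runs (readLoop p) (store [] m (g (w ++ d.enc)).1 (g (w ++ d.enc)).2 c []) s' T) :
    Runs (readLoop p) (store [] (d.enc ++ m) (g w).1 (g w).2 (true :: c) []) s'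
      (T + 5 * d.size) := by
  induction d generalizing m c w s' T with
  | nil =>
    exact Runs.mono (t := 2 + T + 1) (runs_loop_cnt (runs_pop_main (hp false m c w)) h)
      (by simp [Data.size]; omega)
  | cons a b iha ihb =>
    have h1 := ihb (m := m) (c := c) (w := w ++ [true] ++ a.enc)
      (by simpa [Data.enc] using h)
    have h2 := iha h1
    have h3 : Runs (readLoop p) (store [] (true :: (a.enc ++ (b.enc ++ m))) (g w).1 (g w).2
        (true :: c) []) s' (4 + (T + 5 * b.size + 5 * a.size) + 1) :=
      runs_loop_cnt (runs_pop_main ((hp true _ _ w).seq (runs_push_cnt.seq runs_push_cnt))) h2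
    simp only [Data.enc, List.cons_append, List.append_assoc]
    exact h3.mono (by simp [Data.size]; omega)

theorem runs_readTree (hp : ∀ a m c w, Runs (p a) (store [] m (g w).1 (g w).2 c [])
      (store [] m (g (w ++ [a])).1 (g (w ++ [a])).2 c []) 1) (d : Data) (m : List Bool) :
    Runs (readTree p) (store [] (d.enc ++ m) (g []).1 (g []).2 [] [])
      (store [] m (g d.enc).1 (g d.enc).2 [] []) (5 * d.size + 2) := by
  refine (runs_push_cnt.seq (runs_readLoop hp d (s' := _) (T := 1) ?_)).mono
    (by omega)
  exact runs_loop_nil rfl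

end

/-- Move a tree from the main stack to the first auxiliary stack. -/
def toAux1 : Prog := readTree fun a => .push .aux1 a

/-- Move a tree from the main stack to the second auxiliary stack. -/
def toAux2 : Prog := readTree fun a => .push .aux2 a

/-- Remove a tree from the main stack. -/
def drop : Prog := readTree fun _ => .skip

/-- Move everything from the first auxiliary stack to the main stack. -/
def ofAux1 : Prog := .loop .aux1 fun a => .push .main a

/-- Move everything from the second auxiliary stack to the main stack. -/
def ofAux2 : Prog := .loop .aux2 fun a => .push .main a

section
variable (d : Data) (m q r c f l : List Bool)

theorem runs_toAux1 : Runs toAux1 (store [] (d.enc ++ m) q r [] [])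
    (store [] m (d.enc.reverse ++ q) r [] []) (5 * d.size + 2) :=
  runs_readTree (g := fun w => (w.reverse ++ q, r))
    (fun a m c w => runs_push (by simp)) d m

theorem runs_toAux2 : Runs toAux2 (store [] (d.enc ++ m) q r [] [])
    (store [] m q (d.enc.reverse ++ r) [] []) (5 * d.size + 2) :=
  runs_readTree (g := fun w => (q, w.reverse ++ r))
    (fun a m c w => runs_push (by simp)) d m

theorem runs_drop : Runs drop (store [] (d.enc ++ m) q r [] [])
    (store [] m q r [] []) (5 * d.size + 2) :=
  runs_readTree (g := fun _ => (q, r)) (fun _ _ _ _ => runs_skip) d m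

theorem runs_ofAux1 : Runs ofAux1 (store [] m q r c f) (store [] (q.reverse ++ m) [] r c f)
    (2 * q.length + 1) := by
  induction q generalizing m with
  | nil => exact runs_loop_nil rfl
  | cons a q ih =>
    refine Runs.mono (t := 1 + (2 * q.length + 1) + 1) (runs_loop_aux1 runs_push_main ?_)
      (by simp; omega)
    simpa [ofAux1] using ih (a :: m)

theorem runs_ofAux2 : Runs ofAux2 (store [] m q r c f) (store [] (r.reverse ++ m) q [] c f)
    (2 * r.length + 1) := by
  induction r generalizing m with
  | nil => exact runs_loop_nil rfl
  | cons a r ih =>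
    refine Runs.mono (t := 1 + (2 * r.length + 1) + 1) (runs_loop_aux2 runs_push_main ?_)
      (by simp; omega)
    simpa [ofAux2] using ih (a :: m)

end

/-- Move everything from the first auxiliary stack both to the main stack and to the second
auxiliary stack. -/
def forkAux1 : Prog := .loop .aux1 fun a => .seq (.push .main a) (.push .aux2 a)

/-- Move everything from the second auxiliary stack to the first. -/
def aux2ToAux1 : Prog := .loop .aux2 fun a => .push .aux1 a

section
variable (d : Data) (m q r c f l : List Bool)

theorem runs_forkAux1 : Runs forkAux1 (store [] m q r c f)
    (store [] (q.reverse ++ m) [] (q.reverse ++ r) c f) (3 * q.length + 1) := by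
  induction q generalizing m r with
  | nil => exact runs_loop_nil rfl
  | cons a q ih =>
    refine Runs.mono (t := 2 + (3 * q.length + 1) + 1)
      (runs_loop_aux1 (runs_push_main.seq runs_push_aux2) ?_) (by simp; omega)
    simpa [forkAux1] using ih (a :: m) (a :: r)

theorem runs_aux2ToAux1 : Runs aux2ToAux1 (store [] m q r c f)
    (store [] m (r.reverse ++ q) [] c f) (2 * r.length + 1) := by
  induction r generalizing q with
  | nil => exact runs_loop_nil rfl
  | cons a r ih =>
    refine Runs.mono (t := 1 + (2 * r.length + 1) + 1) (runs_loop_aux2 runs_push_aux1 ?_)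
      (by simp; omega)
    simpa [aux2ToAux1] using ih (a :: q)

end

/-- `Computes c x y T`: the program `c` replaces the tree `x` on the main stack by `y` in at most
`T` steps. -/
def Computes (c : Prog) (x y : Data) (T : ℕ) : Prop :=
  ∀ m, Runs c (store [] (x.enc ++ m) [] [] [] []) (store [] (y.enc ++ m) [] [] [] []) T

section
variable {c d : Prog} {x y z : Data} {t t' : ℕ}

theorem Computes.mono (h : Computes c x y t) (ht : t ≤ t') : Computes c x y t' :=
  fun m => (h m).mono ht

/-- A stack grows by at most one letter per step, so a time bound is also a bound on the size of the
result. -/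
theorem Computes.size_le (h : Computes c x y t) : y.size ≤ x.size + t := by
  obtain ⟨n, hn, h⟩ := h []
  have := h.length_le .main
  simp at this
  omega

theorem Computes.comp (h : Computes c x y t) (h' : Computes d y z t') :
    Computes (.seq c d) x z (t + t') := fun m => (h m).seq (h' m)

theorem computes_id (x : Data) : Computes .skip x x 1 := fun _ => runs_skip

/-- Replace a tree by `Data.nil`. -/
def constNil : Prog := .seq drop (.push .main false)

theorem computes_constNil (x : Data) : Computes constNil x .nil (5 * x.size + 3) :=
  fun m => (runs_drop x m [] []).seq runs_push_main

/-- Duplicate a tree. -/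
def dup : Prog := .seq toAux1 (.seq forkAux1 (.seq aux2ToAux1 ofAux1))

theorem runs_dup (x : Data) (m : List Bool) : Runs dup (store [] (x.enc ++ m) [] [] [] [])
    (store [] (x.enc ++ (x.enc ++ m)) [] [] [] []) (12 * x.size + 5) := by
  have h1 := runs_toAux1 x m [] []
  have h2 := runs_forkAux1 m x.enc.reverse [] [] []
  have h3 := runs_aux2ToAux1 (x.enc ++ m) [] x.enc [] []
  have h4 := runs_ofAux1 (x.enc ++ m) x.enc.reverse [] [] []
  simp only [List.append_nil, List.reverse_reverse, List.length_reverse, Data.length_enc] at *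
  exact (h1.seq (h2.seq (h3.seq h4))).mono (by omega)

/-- Exchange the two topmost trees. -/
def swap : Prog := .seq toAux1 (.seq toAux2 (.seq ofAux1 ofAux2))

theorem runs_swap (x y : Data) (m : List Bool) :
    Runs swap (store [] (x.enc ++ (y.enc ++ m)) [] [] [] [])
      (store [] (y.enc ++ (x.enc ++ m)) [] [] [] []) (7 * x.size + 7 * y.size + 6) := by
  have h1 := runs_toAux1 x (y.enc ++ m) [] []
  have h2 := runs_toAux2 y m x.enc.reverse []
  have h3 := runs_ofAux1 m x.enc.reverse y.enc.reverse [] []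
  have h4 := runs_ofAux2 (x.enc ++ m) [] y.enc.reverse [] []
  simp only [List.append_nil, List.reverse_reverse, List.length_reverse, Data.length_enc] at *
  exact (h1.seq (h2.seq (h3.seq h4))).mono (by omega)

/-- Apply two programs to the same tree and pair the results. -/
def pair (c d : Prog) : Prog := .seq dup (.seq d (.seq swap (.seq c (.push .main true))))

/-- The program `d` works on the upper copy first; after the swap, `c` leaves its result on top, so
the pushed letter `true` completes the code of the pair in the right order. -/
theorem computes_pair (hc : Computes c x y t) (hd : Computes d x z t') :
    Computes (pair c d) x (.cons y z) (19 * x.size + 7 * z.size + 12 + t + t') := by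
  intro m
  have h5 : Runs (.push .main true) (store [] (y.enc ++ (z.enc ++ m)) [] [] [] [])
      (store [] ((Data.cons y z).enc ++ m) [] [] [] []) 1 := runs_push (by simp [Data.enc])
  exact ((runs_dup x m).seq ((hd (x.enc ++ m)).seq ((runs_swap z x m).seq
    ((hc (z.enc ++ m)).seq h5)))).mono (by omega)

/-- Replace a pair by its first component. -/
def car : Prog := .pop .main fun o => match o with
  | some true => .seq toAux1 (.seq drop ofAux1)
  | some false => .push .main false
  | none => .skip

theorem computes_car (x : Data) : Computes car x x.car (7 * x.size + 6) := by
  intro m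
  cases x with
  | nil =>
    exact Runs.mono (t := 2) (runs_pop_main (a := false) runs_push_main)
      (by simp [Data.size])
  | cons a b =>
    have h1 := runs_toAux1 a (b.enc ++ m) [] []
    have h2 := runs_drop b m a.enc.reverse []
    have h3 := runs_ofAux1 m a.enc.reverse [] [] []
    simp only [List.append_nil, List.reverse_reverse, List.length_reverse, Data.length_enc] at *
    have h := runs_pop_main (a := true) (g := fun o => match o with
      | some true => .seq toAux1 (.seq drop ofAux1)
      | some false => .push .main false
      | none => .skip) (h1.seq (h2.seq h3))
    simp only [Data.enc, List.cons_append, List.append_assoc]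
    exact h.mono (by simp only [Data.size]; omega)

/-- Replace a pair by its second component. -/
def cdr : Prog := .pop .main fun o => match o with
  | some true => drop
  | some false => .push .main false
  | none => .skip

theorem computes_cdr (x : Data) : Computes cdr x x.cdr (5 * x.size + 3) := by
  intro m
  cases x with
  | nil =>
    exact Runs.mono (t := 2) (runs_pop_main (a := false) runs_push_main)
      (by simp [Data.size])
  | cons a b =>
    have h := runs_pop_main (a := true) (g := fun o => match o with
      | some true => drop
      | some false => .push .main false
      | none => .skip) (runs_drop a (b.enc ++ m) [] [])
    simp only [Data.enc, List.cons_append, List.append_assoc]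
    exact h.mono (by simp only [Data.size]; omega)

/-- On a pair, run `c` or `d` on the second component, depending on whether the first component
is `Data.nil`. -/
def ite (c d : Prog) : Prog := .pop .main fun _ => .pop .main fun o => match o with
  | some true => .seq drop (.seq drop d)
  | some false => c
  | none => .skip

theorem computes_ite_nil (h : Computes c x y t) : Computes (ite c d) (.cons .nil x) y (t + 2) :=
  fun m => runs_pop_main (a := true) (runs_pop_main (a := false) (h m))

theorem computes_ite_cons {a b : Data} (h : Computes d x y t) :
    Computes (ite c d) (.cons (.cons a b) x) y (5 * a.size + 5 * b.size + 6 + t) := by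
  intro m
  have h1 : Runs (ite c d) (store [] (true :: true :: (a.enc ++ (b.enc ++ (x.enc ++ m))))
      [] [] [] []) (store [] (y.enc ++ m) [] [] [] []) _ :=
    runs_pop_main (runs_pop_main ((runs_drop a _ [] []).seq ((runs_drop b _ [] []).seq (h m))))
  simp only [Data.enc, List.cons_append, List.append_assoc]
  exact h1.mono (by omega)

/-- Compare the words on the two auxiliary stacks, and count the differences in unary. -/
def compare : Prog :=
  .seq (.loop .aux1 fun a => .pop .aux2 fun o => if o = some a then .skip else .push .cnt true)
    (.loop .aux2 fun _ => .push .cnt true)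

/-- Only whether the final counter is empty matters, so its contents stay existential; the length
bound is needed to clear it in time. If the second word is the shorter one, the failing pops of the
first loop count as differences; if it is the longer one, the second loop counts the surplus. -/
theorem runs_compare (m q r c : List Bool) : ∃ c', Runs compare (store [] m q r c [])
    (store [] m [] [] c' []) (3 * q.length + 2 * r.length + 2) ∧
    c'.length ≤ c.length + q.length + r.length ∧ (c' = [] ↔ c = [] ∧ q = r) := by
  have h2 : ∀ r c, ∃ c', Runs (.loop .aux2 fun _ => .push .cnt true) (store [] m [] r c [])
      (store [] m [] [] c' []) (2 * r.length + 1) ∧ c'.length ≤ c.length + r.length ∧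
      (c' = [] ↔ c = [] ∧ r = []) := by
    intro r
    induction r with
    | nil => exact fun c => ⟨c, runs_loop_nil rfl, by simp, by simp⟩
    | cons a r ih =>
      intro c
      obtain ⟨c', h, hl, hc⟩ := ih (true :: c)
      refine ⟨c', Runs.mono (t := 1 + (2 * r.length + 1) + 1) (runs_loop_aux2 runs_push_cnt ?_)
        (by simp; omega), by simp at *; omega, by simp [hc]⟩
      simpa using h
  have h1 : ∀ r c, ∃ c' r', Runs (.loop .aux1 fun a => .pop .aux2 fun o =>
      if o = some a then .skip else .push .cnt true) (store [] m q r c [])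
      (store [] m [] r' c' []) (3 * q.length + 1) ∧ r'.length ≤ r.length ∧
      c'.length ≤ c.length + q.length ∧ (c' = [] ∧ r' = [] ↔ c = [] ∧ q = r) := by
    induction q with
    | nil => exact fun r c => ⟨c, r, runs_loop_nil rfl, le_rfl, by simp, by simp [eq_comm]⟩
    | cons a q ih =>
      intro r c
      cases r with
      | nil =>
        obtain ⟨c', r', h, hr, hl, hc⟩ := ih [] (true :: c)
        refine ⟨c', r', Runs.mono (t := 2 + (3 * q.length + 1) + 1)
          (runs_loop_aux1 (runs_pop_none rfl ?_) h) (by simp; omega), hr, by simp at *; omega,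
          by simp [hc]⟩
        simpa using runs_push_cnt
      | cons b r =>
        by_cases e : b = a
        · obtain ⟨c', r', h, hr, hl, hc⟩ := ih r c
          refine ⟨c', r', Runs.mono (t := 2 + (3 * q.length + 1) + 1)
            (runs_loop_aux1 (runs_pop_aux2 ?_) h) (by simp; omega), by simp; omega,
            by simp at *; omega, by simp [hc, e]⟩
          simp only [e, if_true]
          simpa using runs_skip
        · obtain ⟨c', r', h, hr, hl, hc⟩ := ih r (true :: c)
          refine ⟨c', r', Runs.mono (t := 2 + (3 * q.length + 1) + 1)
            (runs_loop_aux1 (runs_pop_aux2 ?_) h) (by simp; omega), by simp; omega,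
            by simp at *; omega, by simp [hc, Ne.symm e]⟩
          simpa [e] using runs_push_cnt
  obtain ⟨c1, r1, g1, hr1, hl1, hc1⟩ := h1 r c
  obtain ⟨c2, g2, hl2, hc2⟩ := h2 r1 c1
  exact ⟨c2, (g1.seq g2).mono (by omega), by omega, by rw [hc2, hc1]⟩

/-- Empty the counter. -/
def clearCnt : Prog := .loop .cnt fun _ => .skip

theorem runs_clearCnt (m c : List Bool) : Runs clearCnt (store [] m [] [] c [])
    (store [] m [] [] [] []) (2 * c.length + 1) := by
  induction c with
  | nil => exact runs_loop_nil rfl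
  | cons a c ih =>
    refine Runs.mono (t := 1 + (2 * c.length + 1) + 1) (runs_loop_cnt runs_skip ?_) (by simp; omega)
    simpa [clearCnt] using ih

/-- Decide whether the components of a pair are equal. -/
def eq : Prog := .pop .main fun _ => .seq toAux1 (.seq toAux2 (.seq compare
  (.pop .cnt fun o => match o with
    | none => .seq (.push .main false) (.seq (.push .main false) (.push .main true))
    | some _ => .seq clearCnt (.push .main false))))

theorem computes_eq (x y : Data) : Computes eq (.cons x y)
    (if x = y then .cons .nil .nil else .nil) (12 * x.size + 12 * y.size + 14) := by
  intro m
  have h1 := runs_toAux1 x (y.enc ++ m) [] []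
  have h2 := runs_toAux2 y m x.enc.reverse []
  obtain ⟨c, h3, hl, hc⟩ := runs_compare m x.enc.reverse y.enc.reverse []
  -- Injectivity of the code turns equality of the reversed words into equality of the trees.
  simp only [List.append_nil, List.length_reverse, Data.length_enc, true_and,
    List.reverse_inj, Data.enc_injective.eq_iff] at *
  have key : Runs eq (store [] (true :: (x.enc ++ (y.enc ++ m))) [] [] [] [])
      (store [] ((if x = y then Data.cons .nil .nil else .nil).enc ++ m) [] [] [] [])
      (5 * x.size + 2 + (5 * y.size + 2 + (3 * x.size + 2 * y.size + 2 +
      (2 * x.size + 2 * y.size + 5))) + 1) := by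
    refine runs_pop_main (h1.seq (h2.seq (h3.seq ?_)))
    cases c with
    | nil =>
      rw [if_pos (hc.1 rfl)]
      exact Runs.mono (t := 1 + (1 + 1) + 1)
        (runs_pop_none rfl (runs_push_main.seq (runs_push_main.seq runs_push_main))) (by omega)
    | cons a c =>
      rw [if_neg (fun h => by simpa using hc.2 h)]
      exact Runs.mono (t := 2 * c.length + 1 + 1 + 1)
        (runs_pop_cnt ((runs_clearCnt m c).seq runs_push_main)) (by simp at hl; omega)
  simp only [Data.enc, List.cons_append, List.append_assoc]
  exact key.mono (by omega)

/-- Set the flag if the main stack holds a pair whose first component is a pair. -/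
def testCar : Prog := .pop .main fun o => match o with
  | some true => .pop .main fun o => match o with
    | some true => .seq (.push .main true) (.seq (.push .main true) (.push .flag true))
    | some false => .seq (.push .main false) (.push .main true)
    | none => .skip
  | some false => .push .main false
  | none => .skip

theorem runs_testCar_nil (x : Data) (m : List Bool) :
    Runs testCar (store [] ((Data.cons .nil x).enc ++ m) [] [] [] [])
      (store [] ((Data.cons .nil x).enc ++ m) [] [] [] []) 4 :=
  runs_pop_main (a := true) (runs_pop_main (a := false) (runs_push_main.seq runs_push_main))

theorem runs_testCar_cons (a b x : Data) (m : List Bool) :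
    Runs testCar (store [] ((Data.cons (.cons a b) x).enc ++ m) [] [] [] [])
      (store [] ((Data.cons (.cons a b) x).enc ++ m) [] [] [] [true]) 5 :=
  runs_pop_main (a := true) (runs_pop_main (a := true)
    (runs_push_main.seq (runs_push_main.seq runs_push_flag)))

/-- Run a program as long as the main stack holds a pair whose first component is a pair. -/
def whileCar (c : Prog) : Prog := .seq testCar (.loop .flag fun _ => .seq c testCar)

theorem computes_whileCar {n : ℕ} (f : ℕ → Data) (x : Data)
    (h : ∀ i < n, Computes c (f i) (f (i + 1)) t)
    (hf : ∀ i < n, ∃ a b y, f i = .cons (.cons a b) y) (hn : f n = .cons .nil x) :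
    Computes (whileCar c) (f 0) (f n) (n * (t + 6) + 6) := by
  intro m
  have test : ∀ i ≤ n, Runs testCar (store [] ((f i).enc ++ m) [] [] [] [])
      (store [] ((f i).enc ++ m) [] [] [] (if i = n then [] else [true])) 5 := by
    intro i hi
    by_cases e : i = n
    · subst e
      rw [if_pos rfl, hn]
      exact Runs.mono (runs_testCar_nil x m) (by omega)
    · obtain ⟨a, b, y, h'⟩ := hf i (by omega)
      rw [if_neg e, h']
      exact runs_testCar_cons a b y m
  -- The induction is on the number `j` of remaining rounds, since a loop unfolds at its first
  -- round. The flag is set exactly as long as a round is left.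
  have main : ∀ j ≤ n, Runs (.loop .flag fun _ => .seq c testCar)
      (store [] ((f (n - j)).enc ++ m) [] [] [] (if n - j = n then [] else [true]))
      (store [] ((f n).enc ++ m) [] [] [] []) (j * (t + 6) + 1) := by
    intro j
    induction j with
    | zero => exact fun _ => by simpa using runs_loop_nil rfl
    | succ j ih =>
      intro hj
      rw [if_neg (by omega)]
      refine Runs.mono (t := t + 5 + (j * (t + 6) + 1) + 1) (runs_loop_flag ?_ (ih (by omega)))
        (by ring_nf; omega)
      have e : n - j = n - (j + 1) + 1 := by omega
      have h1 := h (n - (j + 1)) (by omega) m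
      rw [← e] at h1
      exact h1.seq (test (n - j) (by omega))
  have h0 := test 0 (by omega)
  have h1 := main n le_rfl
  rw [Nat.sub_self] at h1
  exact (h0.seq h1).mono (by omega)

end

end Prog

/-! ## Functions computable in polynomial time -/

/-- `t` is bounded by a polynomial. -/
def PolyBound (t : ℕ → ℕ) : Prop := ∃ e, ∀ n, t n ≤ (n + 2) ^ e

namespace PolyBound

variable {t u : ℕ → ℕ}

theorem mono (h : PolyBound t) (hu : ∀ n, u n ≤ t n) : PolyBound u :=
  let ⟨e, he⟩ := h
  ⟨e, fun n => (hu n).trans (he n)⟩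

theorem id : PolyBound fun n => n := ⟨1, fun n => by simp⟩

/-- The base `n + 2` is at least 2, so a constant lies below a power of it even at `n = 0`. -/
theorem const (c : ℕ) : PolyBound fun _ => c :=
  ⟨c, fun n => Nat.lt_two_pow_self.le.trans (Nat.pow_le_pow_left (by omega) c)⟩

theorem mul (ht : PolyBound t) (hu : PolyBound u) : PolyBound fun n => t n * u n :=
  let ⟨e, he⟩ := ht
  let ⟨e', he'⟩ := hu
  ⟨e + e', fun n => by rw [pow_add]; exact Nat.mul_le_mul (he n) (he' n)⟩

theorem add (ht : PolyBound t) (hu : PolyBound u) : PolyBound fun n => t n + u n := by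
  obtain ⟨e, he⟩ := ht
  obtain ⟨e', he'⟩ := hu
  refine ⟨e + e' + 1, fun n => ?_⟩
  have h1 : (n + 2) ^ e ≤ (n + 2) ^ (e + e') := Nat.pow_le_pow_right (by omega) (by omega)
  have h2 : (n + 2) ^ e' ≤ (n + 2) ^ (e + e') := Nat.pow_le_pow_right (by omega) (by omega)
  rw [pow_succ]
  nlinarith [he n, he' n]

theorem pow (ht : PolyBound t) (e : ℕ) : PolyBound fun n => t n ^ e := by
  induction e with
  | zero => simpa using const 1
  | succ e ih => simpa only [pow_succ] using ih.mul ht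

theorem comp (ht : PolyBound t) (hu : PolyBound u) : PolyBound fun n => t (u n) :=
  let ⟨_, he⟩ := ht
  ((hu.add (const 2)).pow _).mono fun n => he (u n)

end PolyBound

/-! ### Types presented by trees -/

/-- A type whose elements are presented by trees. -/
class DataRep (α : Type) where
  toData : α → Data
  injective : Function.Injective toData

namespace DataRep

variable {α β : Type} [DataRep α] [DataRep β]

instance : DataRep (α × β) where
  toData p := .cons (toData p.1) (toData p.2)
  injective p q h := by
    simp only [Data.cons.injEq] at h
    exact Prod.ext (injective h.1) (injective h.2)

instance : DataRep Bool where
  toData b := bif b then .cons .nil .nil else .nil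
  injective a b h := by cases a <;> cases b <;> simp_all

/-- The tree that presents a list. -/
def listData : List α → Data
  | [] => .nil
  | a :: l => .cons (toData a) (listData l)

instance : DataRep (List α) where
  toData := listData
  injective l := by
    induction l with
    | nil => intro l' h; cases l' <;> simp_all [listData]
    | cons a l ih =>
      intro l' h
      cases l' with
      | nil => simp [listData] at h
      | cons a' l' =>
        simp only [listData, Data.cons.injEq] at h
        rw [DataRep.injective h.1, ih h.2]

instance : DataRep GWMMInstance.Sym where
  toData s := match s with
    | .bit b => .cons .nil (toData b)
    | .eps => .cons (.cons .nil .nil) (.cons .nil .nil)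
    | .comma => .cons (.cons .nil .nil) .nil
    | .hash => .nil
  injective s t h := by
    rcases s with (_ | _) | _ | _ | _ <;> rcases t with (_ | _) | _ | _ | _ <;>
      simp_all [toData]

end DataRep

open DataRep

/-- The size of the tree that presents `a`. -/
def repSize {α : Type} [DataRep α] (a : α) : ℕ := (toData a).size

section
variable {α β : Type} [DataRep α] [DataRep β]

@[simp] theorem repSize_pair (a : α) (b : β) : repSize (a, b) = repSize a + repSize b + 1 := rfl
@[simp] theorem repSize_nil : repSize ([] : List α) = 1 := rfl
@[simp] theorem repSize_cons (a : α) (l : List α) :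
    repSize (a :: l) = repSize a + repSize l + 1 := rfl
theorem repSize_bool (b : Bool) : repSize b ≤ 3 := by cases b <;> decide
theorem repSize_sym (s : GWMMInstance.Sym) : repSize s ≤ 7 := by
  rcases s with (_ | _) | _ | _ | _ <;> decide
theorem repSize_pos (a : α) : 1 ≤ repSize a := Data.size_pos _

theorem repSize_append (l l' : List α) : repSize (l ++ l') ≤ repSize l + repSize l' := by
  induction l with
  | nil => simp
  | cons a l ih => simp; omega

theorem repSize_le_of_mem {a : α} {l : List α} (h : a ∈ l) : repSize a ≤ repSize l := by
  induction h with
  | head l => simp; omega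
  | tail b _ ih => simp; omega

theorem length_le_repSize (l : List α) : l.length ≤ repSize l := by
  induction l with
  | nil => simp
  | cons a l ih => simp; omega

theorem repSize_list_le {l : List α} {B : ℕ} (h : ∀ a ∈ l, repSize a ≤ B) :
    repSize l ≤ l.length * (B + 1) + 1 := by
  induction l with
  | nil => simp
  | cons a l ih =>
    have h1 := ih fun b hb => h b (by simp [hb])
    have h2 := h a (by simp)
    simp only [repSize_cons, List.length_cons, Nat.add_mul]
    omega

theorem repSize_drop_le (l : List α) (n : ℕ) : repSize (l.drop n) ≤ repSize l := by
  induction l generalizing n with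
  | nil => simp
  | cons a l ih =>
    cases n with
    | zero => simp
    | succ n => have := ih n; simp; omega

end

/-! ### Closure properties of polynomial time -/

/-- `f` is computed in polynomial time by a program on the stacks `Stk`. -/
def PolyTime {α β : Type} [DataRep α] [DataRep β] (f : α → β) : Prop :=
  ∃ (c : Prog) (e : ℕ), ∀ a, c.Computes (toData a) (toData (f a)) ((repSize a + 2) ^ e)

namespace PolyTime

variable {α β γ σ : Type} [DataRep α] [DataRep β] [DataRep γ] [DataRep σ]

theorem of_bound {f : α → β} (c : Prog) {t : ℕ → ℕ} (ht : PolyBound t)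
    (h : ∀ a, c.Computes (toData a) (toData (f a)) (t (repSize a))) : PolyTime f :=
  let ⟨e, he⟩ := ht
  ⟨c, e, fun a => (h a).mono (he _)⟩

theorem size_le {f : α → β} (h : PolyTime f) : ∃ e, ∀ a, repSize (f a) ≤ (repSize a + 2) ^ e := by
  obtain ⟨c, e, h⟩ := h
  obtain ⟨e', he'⟩ := PolyBound.id.add ((PolyBound.id.add (.const 2)).pow e)
  exact ⟨e', fun a => (h a).size_le.trans (he' _)⟩

theorem id : PolyTime fun a : α => a :=
  of_bound .skip (.const 1) fun _ => Prog.computes_id _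

theorem comp {f : β → γ} {g : α → β} (hf : PolyTime f) (hg : PolyTime g) :
    PolyTime fun a => f (g a) := by
  obtain ⟨e', he'⟩ := hg.size_le
  obtain ⟨c, e, hf⟩ := hf
  obtain ⟨c', e'', hg⟩ := hg
  have h2 (k : ℕ) : PolyBound fun n => (n + 2) ^ k := (PolyBound.id.add (.const 2)).pow k
  refine of_bound (.seq c' c) ((h2 e'').add ((h2 e).comp (h2 e'))) fun a => ?_
  refine (hg a).comp ((hf (g a)).mono ?_)
  exact Nat.pow_le_pow_left (by have := he' a; omega) e

theorem data_pair {f : α → β} {g : α → γ} {h : α → σ} (hf : PolyTime f) (hg : PolyTime g)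
    (e : ∀ a, toData (h a) = .cons (toData (f a)) (toData (g a))) : PolyTime h := by
  obtain ⟨e', he'⟩ := hg.size_le
  obtain ⟨c, e1, hf⟩ := hf
  obtain ⟨c', e2, hg⟩ := hg
  have h2 (k : ℕ) : PolyBound fun n => (n + 2) ^ k := (PolyBound.id.add (.const 2)).pow k
  refine of_bound (.pair c c') ((((((PolyBound.const 19).mul .id).add
    ((PolyBound.const 7).mul (h2 e'))).add (.const 12)).add (h2 e1)).add (h2 e2)) fun a => ?_
  rw [e]
  refine (Prog.computes_pair (hf a) (hg a)).mono ?_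
  have := he' a
  unfold repSize at *
  omega

theorem pair {f : α → β} {g : α → γ} (hf : PolyTime f) (hg : PolyTime g) :
    PolyTime fun a => (f a, g a) := data_pair hf hg fun _ => rfl

theorem cons {f : α → β} {g : α → List β} (hf : PolyTime f) (hg : PolyTime g) :
    PolyTime fun a => f a :: g a := data_pair hf hg fun _ => rfl

theorem fst : PolyTime (Prod.fst : α × β → α) :=
  of_bound .car (((PolyBound.const 7).mul .id).add (.const 6)) fun a =>
    Prog.computes_car (toData a)

theorem snd : PolyTime (Prod.snd : α × β → β) :=
  of_bound .cdr (((PolyBound.const 5).mul .id).add (.const 3)) fun a =>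
    Prog.computes_cdr (toData a)

/-- The program is built by recursion on the fixed tree. Its time is linear in the discarded input,
with a factor that depends on the fixed tree only. -/
theorem const (b : β) : PolyTime fun _ : α => b := by
  have key : ∀ d : Data, ∃ c k, ∀ x, Prog.Computes c x d (k * x.size) := by
    intro d
    induction d with
    | nil =>
      refine ⟨.constNil, 8, fun x => (Prog.computes_constNil x).mono ?_⟩
      have := x.size_pos; omega
    | cons d d' ih ih' =>
      obtain ⟨c, k, h⟩ := ih
      obtain ⟨c', k', h'⟩ := ih'
      refine ⟨.pair c c', 19 + 7 * d'.size + 12 + k + k', fun x =>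
        (Prog.computes_pair (h x) (h' x)).mono ?_⟩
      have := x.size_pos
      have : 7 * d'.size * 1 ≤ 7 * d'.size * x.size := Nat.mul_le_mul_left _ this
      simp only [Nat.add_mul]
      omega
  obtain ⟨c, k, h⟩ := key (toData b)
  exact of_bound c ((PolyBound.const k).mul .id) fun a => h _

theorem cond {c : α → Bool} {f g : α → β} (hc : PolyTime c) (hf : PolyTime f) (hg : PolyTime g) :
    PolyTime fun a => bif c a then f a else g a := by
  obtain ⟨p, e, hp⟩ := hc.pair (id (α := α))
  obtain ⟨c1, e1, h1⟩ := hf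
  obtain ⟨c2, e2, h2⟩ := hg
  have h (k : ℕ) : PolyBound fun n => (n + 2) ^ k := (PolyBound.id.add (.const 2)).pow k
  -- The branches are exchanged because `Prog.ite` takes the `Data.nil` branch first, and `Data.nil`
  -- presents `false`.
  refine of_bound (.seq p (Prog.ite c2 c1)) ((h e).add (((h e1).add (h e2)).add (.const 16)))
    fun a => (hp a).comp ?_
  cases hca : c a with
  | false =>
    have := Prog.computes_ite_nil (d := c1) (h2 a)
    simp only [toData, hca, cond_false]
    exact this.mono (by omega)
  | true =>
    have := Prog.computes_ite_cons (a := .nil) (b := .nil) (c := c2) (h1 a)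
    simp only [toData, hca, cond_true]
    exact this.mono (by simp [Data.size]; omega)

/-- Definition of a function by cases on a list. -/
def listCases {α β γ : Type} (g : α → γ) (h : (β × List β) × α → γ) (l : List β) (a : α) : γ :=
  match l with
  | [] => g a
  | b :: l => h ((b, l), a)

/-- The list is computed twice: one copy is consumed by the test and the other is handed to the
branch. A nonempty list `b :: l` and the pair `(b, l)` are presented by the same tree, so the branch
needs no conversion. -/
theorem cases {f : α → List β} {g : α → γ} {h : (β × List β) × α → γ} (hf : PolyTime f)
    (hg : PolyTime g) (hh : PolyTime h) : PolyTime fun a => listCases g h (f a) a := by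
  obtain ⟨e', he'⟩ := hf.size_le
  obtain ⟨p, e, hp⟩ := hf.pair (hf.pair (id (α := α)))
  obtain ⟨c1, e1, h1⟩ := hg.comp (snd (α := List β) (β := α))
  obtain ⟨c2, e2, h2⟩ := hh
  have h (k : ℕ) : PolyBound fun n => (n + 2) ^ k := (PolyBound.id.add (.const 2)).pow k
  have hn := ((h e').add PolyBound.id).add (.const 1)
  refine of_bound (.seq p (Prog.ite c1 c2)) ((h e).add ((((h e1).comp hn).add ((h e2).comp hn)).add
    (((PolyBound.const 5).mul (h e')).add (.const 6))))
    fun a => (hp a).comp ?_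
  have hfa := he' a
  cases hl : f a with
  | nil =>
    have := Prog.computes_ite_nil (d := c2) (h1 (f a, a))
    rw [hl] at this hfa
    simp only [hl]
    refine Prog.Computes.mono this ?_
    have := Nat.pow_le_pow_left (show repSize (([] : List β), a) + 2 ≤
      (repSize a + 2) ^ e' + repSize a + 1 + 2 by simp at *; omega) e1
    omega
  | cons b l =>
    have := Prog.computes_ite_cons (a := toData b) (b := toData l) (c := c1) (h2 ((b, l), a))
    rw [hl] at hfa
    simp only [hl]
    refine Prog.Computes.mono this ?_
    have := Nat.pow_le_pow_left (show repSize ((b, l), a) + 2 ≤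
      (repSize a + 2) ^ e' + repSize a + 1 + 2 by simp at *; omega) e2
    simp only [repSize_cons] at hfa
    unfold repSize at *
    omega

theorem eq [DecidableEq β] {f g : α → β} (hf : PolyTime f) (hg : PolyTime g) :
    PolyTime fun a => decide (f a = g a) := by
  have : PolyTime fun p : β × β => decide (p.1 = p.2) := by
    refine of_bound .eq (((PolyBound.const 12).mul .id).add (.const 14)) fun a => ?_
    have h := Prog.computes_eq (toData a.1) (toData a.2)
    simp only [DataRep.injective.eq_iff] at h
    have e : toData (decide (a.1 = a.2)) = if a.1 = a.2 then Data.cons .nil .nil else .nil := by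
      by_cases h : a.1 = a.2 <;> simp [h, toData]
    rw [e]
    refine h.mono ?_
    simp only [repSize, toData, Data.size]
    omega
  exact this.comp (hf.pair hg)

/-- The program for a fold runs in polynomial time in the size of its input and of the
intermediate results. -/
theorem foldl_budget {f : α → List β} {g : α → σ} {h : (α × σ) × β → σ} (hf : PolyTime f)
    (hg : PolyTime g) (hh : PolyTime h) : ∃ (c : Prog) (e : ℕ), ∀ a B,
      (∀ l, l <+: f a → repSize (l.foldl (fun s b => h ((a, s), b)) (g a)) ≤ B) →
      c.Computes (toData a) (toData ((f a).foldl (fun s b => h ((a, s), b)) (g a)))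
        ((repSize a + B + 2) ^ e) := by
  obtain ⟨ef, hfs⟩ := hf.size_le
  obtain ⟨c0, e0, h0⟩ := hf.pair ((id (α := α)).pair hg)
  -- One round of the loop acts on the remaining list, the parameter and the accumulator. The
  -- remaining list is the first component, so that `Prog.whileCar` stops when it is empty.
  have hbody : PolyTime fun p : (β × List β) × (α × σ) =>
      (p.1.2, (p.2.1, h ((p.2.1, p.2.2), p.1.1))) :=
    (snd.comp fst).pair ((fst.comp snd).pair (hh.comp (((fst.comp snd).pair
      (snd.comp snd)).pair (fst.comp fst))))
  obtain ⟨c1, e1, h1⟩ := hbody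
  obtain ⟨c2, e2, h2⟩ := (snd (α := α) (β := σ)).comp (snd (α := List β) (β := α × σ))
  have hp (k : ℕ) : PolyBound fun n => (n + 2) ^ k := (PolyBound.id.add (.const 2)).pow k
  have hn := ((hp ef).add PolyBound.id).add (.const 2)
  obtain ⟨e, he⟩ := (hp e0).add ((((hp ef).mul (((hp e1).comp hn).add (.const 6))).add
    (.const 6)).add ((hp e2).comp hn))
  refine ⟨.seq c0 (.seq (Prog.whileCar c1) c2), e, fun a B hB => ?_⟩
  set k := fun (s : σ) (b : β) => h ((a, s), b) with hk
  set N := repSize a + B with hN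
  have hfN : repSize (f a) ≤ (N + 2) ^ ef :=
    (hfs a).trans (Nat.pow_le_pow_left (by omega) ef)
  have hst : ∀ i, repSize ((f a).drop i, (a, ((f a).take i).foldl k (g a))) ≤
      (N + 2) ^ ef + N + 2 := by
    intro i
    have := repSize_drop_le (f a) i
    have := hB _ ((f a).take_prefix i)
    simp only [repSize_pair]
    omega
  -- Before round `i` the accumulator is the fold over the first `i` elements; this is a prefix of
  -- the list, so the budget `B` applies.
  have hw := Prog.computes_whileCar (c := c1) (n := (f a).length)
    (t := ((N + 2) ^ ef + N + 2 + 2) ^ e1)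
    (fun i => toData ((f a).drop i, (a, ((f a).take i).foldl k (g a))))
    (toData (a, (f a).foldl k (g a))) ?_ ?_ ?_
  · refine (Prog.Computes.comp ((h0 a).mono (Nat.pow_le_pow_left
      (show repSize a + 2 ≤ N + 2 by omega) e0)) (Prog.Computes.comp (hw.mono
      (t' := (N + 2) ^ ef * (((N + 2) ^ ef + N + 2 + 2) ^ e1 + 6) + 6) ?_) ?_)).mono (he N)
    · have := length_le_repSize (f a)
      exact Nat.add_le_add_right (Nat.mul_le_mul_right _ (this.trans hfN)) _
    · have := (h2 ((f a).drop (f a).length, (a, ((f a).take (f a).length).foldl k (g a)))).mono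
        (Nat.pow_le_pow_left (Nat.add_le_add_right (hst _) 2) e2)
      simpa using this
  · intro i hi
    have hd : (f a).drop i = (f a)[i] :: (f a).drop (i + 1) := by simp
    have := (h1 (((f a)[i], (f a).drop (i + 1)), (a, ((f a).take i).foldl k (g a)))).mono
        (t' := ((N + 2) ^ ef + N + 2 + 2) ^ e1) (by
      refine Nat.pow_le_pow_left (Nat.add_le_add_right (le_trans (le_of_eq ?_) (hst i)) 2) e1
      simp only [repSize_pair, hd, repSize_cons])
    have ht : ((f a).take (i + 1)).foldl k (g a) = k (((f a).take i).foldl k (g a)) (f a)[i] := by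
      rw [List.take_succ_eq_append_getElem hi, List.foldl_append]; rfl
    simp only [ht]
    rw [hd]
    exact this
  · intro i hi
    have hd : (f a).drop i = (f a)[i] :: (f a).drop (i + 1) := by simp
    rw [hd]
    exact ⟨_, _, _, rfl⟩
  · simp [toData, listData]

omit [DataRep β] in
theorem repSize_foldl_le {k : σ → β → σ} {M : ℕ} {l : List β}
    (h : ∀ s, ∀ b ∈ l, repSize (k s b) ≤ repSize s + M) (s : σ) :
    repSize (l.foldl k s) ≤ repSize s + l.length * M := by
  induction l generalizing s with
  | nil => simp
  | cons b l ih =>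
    have h1 := ih (fun s b hb => h s b (by simp [hb])) (k s b)
    have h2 := h s b (by simp)
    simp only [List.foldl_cons, List.length_cons, Nat.add_mul]
    omega

/-- The size of the result grows additively. -/
def Growth (h : (α × σ) × β → σ) : Prop :=
  ∃ e, ∀ a s b, repSize (h ((a, s), b)) ≤ repSize s + (repSize a + repSize b + 2) ^ e

/-- With additive growth the intermediate results stay below the initial size plus the list length
times one increment. A step that is merely polynomial-time could, for instance, double the size in
each round. -/
theorem foldl {f : α → List β} {g : α → σ} {h : (α × σ) × β → σ} (hf : PolyTime f)
    (hg : PolyTime g) (hh : PolyTime h) (hG : Growth h) :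
    PolyTime fun a => (f a).foldl (fun s b => h ((a, s), b)) (g a) := by
  obtain ⟨c, e, H⟩ := foldl_budget hf hg hh
  obtain ⟨ef, hfs⟩ := hf.size_le
  obtain ⟨eg, hgs⟩ := hg.size_le
  obtain ⟨eG, hG⟩ := hG
  have hp (k : ℕ) : PolyBound fun n => (n + 2) ^ k := (PolyBound.id.add (.const 2)).pow k
  refine of_bound c ((hp e).comp (PolyBound.id.add ((hp eg).add ((hp ef).mul
    ((hp eG).comp (PolyBound.id.add (hp ef))))))) fun a => H a _ fun l hl => ?_
  have h1 := repSize_foldl_le (k := fun s b => h ((a, s), b)) (l := l)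
    (M := (repSize a + (repSize a + 2) ^ ef + 2) ^ eG) (fun s b hb => by
      refine (hG a s b).trans (Nat.add_le_add_left (Nat.pow_le_pow_left ?_ _) _)
      have := repSize_le_of_mem (hl.subset hb)
      have := hfs a
      omega) (g a)
  refine h1.trans (Nat.add_le_add (hgs a) (Nat.mul_le_mul_right _ ?_))
  exact (hl.length_le.trans (length_le_repSize _)).trans (hfs a)

theorem reverse {f : α → List β} (hf : PolyTime f) : PolyTime fun a => (f a).reverse := by
  have : PolyTime fun l : List β => l.foldl (fun s b => b :: s) [] :=
    foldl (h := fun p => p.2 :: p.1.2) id (const []) (snd.cons (snd.comp fst))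
      ⟨1, fun a s b => by simp; omega⟩
  have h := this.comp hf
  simpa [List.foldl_flip_cons_eq_append] using h

theorem foldr {f : α → List β} {g : α → σ} {h : (α × σ) × β → σ} (hf : PolyTime f)
    (hg : PolyTime g) (hh : PolyTime h) (hG : Growth h) :
    PolyTime fun a => (f a).foldr (fun b s => h ((a, s), b)) (g a) := by
  have := foldl hf.reverse hg hh hG
  simpa using this

theorem append {f g : α → List β} (hf : PolyTime f) (hg : PolyTime g) :
    PolyTime fun a => f a ++ g a := by
  have := foldr (h := fun p => p.2 :: p.1.2) hf hg (snd.cons (snd.comp fst))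
    ⟨1, fun a s b => by simp; omega⟩
  simpa using this

/-- The slack 7 pays for the new constructors and for a truth value or symbol in the accumulator. -/
theorem growth_of_le {h : (α × σ) × β → σ} {k : α × β → γ} (hk : PolyTime k)
    (H : ∀ a s b, repSize (h ((a, s), b)) ≤ repSize s + repSize (k (a, b)) + 7) : Growth h := by
  obtain ⟨e, he⟩ := hk.size_le
  obtain ⟨e', he'⟩ := (((PolyBound.id.add (.const 1)).add (.const 2)).pow e).add (.const 7)
  refine ⟨e', fun a s b => (H a s b).trans ?_⟩
  have h1 := he (a, b)
  have h2 := he' (repSize a + repSize b)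
  rw [repSize_pair] at h1
  simp only at h2
  omega

theorem flatMap {f : α → List β} {k : α × β → List γ} (hf : PolyTime f) (hk : PolyTime k) :
    PolyTime fun a => (f a).flatMap fun b => k (a, b) := by
  have := foldr (h := fun p => k (p.1.1, p.2) ++ p.1.2) hf (const [])
    ((hk.comp ((fst.comp fst).pair snd)).append (snd.comp fst))
    (growth_of_le hk fun a s b => (repSize_append _ _).trans (by simp; omega))
  refine (congrArg PolyTime ?_).mp this
  funext a
  induction f a with
  | nil => rfl
  | cons b l ih => simp [ih]

theorem map {f : α → List β} {k : α × β → γ} (hf : PolyTime f) (hk : PolyTime k) :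
    PolyTime fun a => (f a).map fun b => k (a, b) := by
  have := flatMap hf (hk.cons (const []))
  refine (congrArg PolyTime ?_).mp this
  funext a
  induction f a with
  | nil => rfl
  | cons b l ih => simp only [List.flatMap_cons, List.map_cons, ih, List.singleton_append]

theorem any {f : α → List β} {k : α × β → Bool} (hf : PolyTime f) (hk : PolyTime k) :
    PolyTime fun a => (f a).any fun b => k (a, b) := by
  have := foldr (h := fun p => bif k (p.1.1, p.2) then true else p.1.2) hf (const false)
    ((hk.comp ((fst.comp fst).pair snd)).cond (const true) (snd.comp fst))
    (growth_of_le hk fun a s b => by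
      have := repSize_bool (bif k (a, b) then true else s); simp only; omega)
  refine (congrArg PolyTime ?_).mp this
  funext a
  induction f a with
  | nil => rfl
  | cons b l ih => simp only [List.foldr_cons, List.any_cons, ih]; cases k (a, b) <;> rfl

theorem all {f : α → List β} {k : α × β → Bool} (hf : PolyTime f) (hk : PolyTime k) :
    PolyTime fun a => (f a).all fun b => k (a, b) := by
  have := foldr (h := fun p => bif k (p.1.1, p.2) then p.1.2 else false) hf (const true)
    ((hk.comp ((fst.comp fst).pair snd)).cond (snd.comp fst) (const false))
    (growth_of_le hk fun a s b => by
      have := repSize_bool (bif k (a, b) then s else false); simp only; omega)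
  refine (congrArg PolyTime ?_).mp this
  funext a
  induction f a with
  | nil => rfl
  | cons b l ih => simp only [List.foldr_cons, List.all_cons, ih]; cases k (a, b) <;> rfl

theorem insert [DecidableEq β] {f : α → β} {g : α → List β} (hf : PolyTime f) (hg : PolyTime g) :
    PolyTime fun a => (g a).insert (f a) := by
  have := (any hg ((hf.comp fst).eq (snd (α := α) (β := β)))).cond hg (hf.cons hg)
  refine (congrArg PolyTime ?_).mp this
  funext a
  by_cases h : f a ∈ g a
  · have : (g a).any (fun b => decide (f a = b)) = true := by simpa using h
    simp [h, this]
  · have : (g a).any (fun b => decide (f a = b)) = false := by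
      simp only [List.any_eq_false, decide_eq_true_eq]
      exact fun b hb e => h (e ▸ hb)
    simp [h, this]

end PolyTime

/-! ## The algorithm -/

namespace GWMMInstance

open PolyTime

/-- Numbers and letters as they occur in the description of an instance. -/
abbrev Token : Type := List Sym

/-- Prepend a symbol to a description that is already divided into sections of tokens. -/
def parseStep (s : Sym) (p : List (List Token)) : List (List Token) :=
  match s, p with
  | .hash, p => [] :: p
  | .comma, [] => []
  | .comma, u :: p => ([] :: u) :: p
  | .bit b, (t :: u) :: p => ((.bit b :: t) :: u) :: p
  | .eps, (t :: u) :: p => ((.eps :: t) :: u) :: p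
  | _, p => p

/-- Divide a description into sections of tokens. -/
def parse (w : List Sym) : List (List Token) := w.foldr parseStep []

/-! ### Recovering the tokens of a description -/

section Parse

/-- The description is folded from the right, so the terminating comma is met first: it opens an
empty token, to which the symbols are then prepended. -/
theorem parse_token {t : Token} (ht : ∀ s ∈ t, s ≠ .comma ∧ s ≠ .hash) {w : List Sym}
    {u : List Token} {p : List (List Token)} (hw : parse w = u :: p) :
    parse (t ++ .comma :: w) = (t :: u) :: p := by
  induction t with
  | nil => simp only [parse] at hw; simp [parse, hw, parseStep]
  | cons s t ih =>
    have h := ih fun s hs => ht s (by simp [hs])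
    have hs := ht s (by simp)
    simp only [parse] at h
    simp only [parse, List.cons_append, List.foldr_cons, h]
    cases s <;> simp_all [parseStep]

theorem parse_tokens {l : List Token} (hl : ∀ t ∈ l, ∀ s ∈ t, s ≠ Sym.comma ∧ s ≠ Sym.hash)
    {w : List Sym} {u : List Token} {p : List (List Token)} (hw : parse w = u :: p) :
    parse (l.flatMap (· ++ [Sym.comma]) ++ w) = (l ++ u) :: p := by
  induction l with
  | nil => simpa using hw
  | cons t l ih =>
    have h := parse_token (hl t (by simp)) (ih fun t ht => hl t (by simp [ht]))
    simpa using h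

theorem parse_encodeList {α : Type} {e : α → List Sym} {toks : α → List Token} (l : List α)
    (he : ∀ a, e a = (toks a).flatMap (· ++ [Sym.comma]))
    (ht : ∀ a, ∀ t ∈ toks a, ∀ s ∈ t, s ≠ Sym.comma ∧ s ≠ Sym.hash) (w : List Sym) :
    parse (encodeList e l ++ w) = l.flatMap toks :: parse w := by
  have h : parse (Sym.hash :: w) = [] :: parse w := rfl
  have := parse_tokens (l := l.flatMap toks) (fun t h => by
    obtain ⟨a, _, h⟩ := List.mem_flatMap.1 h
    exact ht a t h) h
  rw [List.append_nil] at this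
  rw [← this, encodeList, List.append_assoc, List.flatMap_assoc]
  simp only [← he]
  rfl

/-- The token of a number. -/
def natToken (n : ℕ) : Token := n.bits.map Sym.bit

/-- The token of a letter. -/
def letterToken : Letter → Token
  | none => [.eps]
  | some a => natToken a

theorem encodeNat_eq (n : ℕ) : encodeNat n = natToken n ++ [.comma] := rfl

theorem encodeLetter_eq (a : Letter) : encodeLetter a = letterToken a ++ [.comma] := by
  cases a <;> rfl

theorem natToken_clean (n : ℕ) : ∀ s ∈ natToken n, s ≠ Sym.comma ∧ s ≠ Sym.hash := by
  intro s hs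
  obtain ⟨b, _, rfl⟩ := List.mem_map.1 hs
  simp

theorem letterToken_clean (a : Letter) : ∀ s ∈ letterToken a, s ≠ Sym.comma ∧ s ≠ Sym.hash := by
  cases a with
  | none => simp [letterToken]
  | some a => exact natToken_clean a

/-- The number that a token presents. -/
def tokenVal : Token → ℕ
  | [] => 0
  | s :: t => (if s = .bit true then 1 else 0) + 2 * tokenVal t

theorem tokenVal_natToken (n : ℕ) : tokenVal (natToken n) = n := by
  induction n using Nat.strong_induction_on with
  | _ n ih =>
    rcases Nat.even_or_odd' n with ⟨k, rfl | rfl⟩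
    · rcases Nat.eq_zero_or_pos k with rfl | hk
      · rfl
      · have := ih k (by omega)
        rw [natToken] at this
        rw [natToken, Nat.bit0_bits k (by omega)]
        simp [tokenVal, this]
    · have := ih k (by omega)
      rw [natToken] at this
      rw [natToken, Nat.bit1_bits k]
      simp [tokenVal, this]
      omega

theorem natToken_injective : Function.Injective natToken :=
  Function.LeftInverse.injective tokenVal_natToken

theorem letterToken_injective : Function.Injective letterToken := by
  intro a b h
  cases a <;> cases b
  · rfl
  · rename_i b
    have : Sym.eps ∈ natToken b := by
      have : letterToken none = natToken b := h
      simp [← this, letterToken]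
    simp [natToken] at this
  · rename_i b
    have : Sym.eps ∈ natToken b := by
      have : natToken b = letterToken none := h
      simp [this, letterToken]
    simp [natToken] at this
  · exact congrArg some (natToken_injective h)

end Parse

/-- Reading the input stack letter by letter yields the reversed list, and on the reversed list the
right fold of `parse` becomes a left fold. -/
theorem polyTime_parse : PolyTime fun w : List Sym => parse w.reverse := by
  let h : (List Sym × List (List Token)) × Sym → List (List Token) := fun p =>
    bif decide (p.2 = Sym.hash) then [] :: p.1.2 else
    bif decide (p.2 = Sym.comma) then listCases (fun _ => []) (fun q => ([] :: q.1.1) :: q.1.2)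
      p.1.2 p else
    listCases (fun p => p.1.2) (fun q => listCases (fun q => q.2.1.2)
      (fun r => ((r.2.2.2 :: r.1.1) :: r.1.2) :: r.2.1.2) q.1.1 q) p.1.2 p
  have e : ∀ p, h p = parseStep p.2 p.1.2 := by
    rintro ⟨⟨w, _ | ⟨_ | ⟨t, u⟩, p⟩⟩, _ | _ | _ | _⟩ <;> rfl
  have hh : PolyTime h := by
    refine (snd.eq (const _)).cond ((const []).cons (snd.comp fst))
      ((snd.eq (const _)).cond (cases (snd.comp fst) (const _) ?_)
        (cases (snd.comp fst) (snd.comp fst) (cases (fst.comp fst)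
          (snd.comp (fst.comp snd)) ?_)))
    · exact ((const []).cons (fst.comp fst)).cons (snd.comp fst)
    · exact (((snd.comp (snd.comp snd)).cons (fst.comp fst)).cons (snd.comp fst)).cons
        (snd.comp (fst.comp snd))
  have hG : Growth h := growth_of_le (k := fun p : List Sym × Sym => p) PolyTime.id
    fun a s b => by
      rw [e]
      have := repSize_sym b
      rcases s with _ | ⟨_ | ⟨t, u⟩, p⟩ <;> rcases b with _ | _ | _ | _ <;>
        simp [parseStep] <;> omega
  have := foldl (PolyTime.id) (const []) hh hG
  simpa only [e, parse, List.foldr_reverse] using this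

/-- Group the elements of a list into pairs. -/
def pairUp {α : Type} (l : List α) : List (α × α) :=
  (l.foldr (fun a s => match s with
    | ([], l) => ([a], l)
    | (b :: _, l) => ([], (a, b) :: l)) (([], []) : List α × List (α × α))).2

theorem pairUp_flatMap {α β : Type} (f g : β → α) (l : List β) :
    pairUp (l.flatMap fun b => [f b, g b]) = l.map fun b => (f b, g b) := by
  have : (l.flatMap fun b => [f b, g b]).foldr (fun a s => match s with
    | ([], l) => ([a], l)
    | (b :: _, l) => ([], (a, b) :: l)) (([], []) : List α × List (α × α)) =
      ([], l.map fun b => (f b, g b)) := by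
    induction l with
    | nil => rfl
    | cons b l ih => simp [ih]
  rw [pairUp, this]

theorem polyTime_pairUp {α : Type} [DataRep α] : PolyTime (pairUp (α := α)) := by
  let h : (List α × (List α × List (α × α))) × α → List α × List (α × α) := fun p =>
    listCases (fun p => ([p.2], p.1.2.2)) (fun q => ([], (q.2.2, q.1.1) :: q.2.1.2.2)) p.1.2.1 p
  have hh : PolyTime h := by
    refine cases (fst.comp (snd.comp fst)) ?_ ?_
    · exact (snd.cons (const [])).pair (snd.comp (snd.comp fst))
    · exact (const []).pair (((snd.comp snd).pair (fst.comp fst)).cons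
        (snd.comp (snd.comp (fst.comp snd))))
  have hG : Growth h := growth_of_le (k := fun p : List α × α => p) PolyTime.id
    fun a s b => by
      rcases s with ⟨_ | ⟨c, u⟩, l⟩ <;> simp [h, listCases] <;> omega
  have := snd.comp (foldr PolyTime.id (const ([], [])) hh hG)
  refine (congrArg PolyTime ?_).mp this
  funext l
  unfold pairUp
  congr 2
  funext a s
  rcases s with ⟨_ | ⟨c, u⟩, l⟩ <;> rfl

theorem polyTime_headD {α β : Type} [DataRep α] [DataRep β] {f : α → List β} (hf : PolyTime f)
    (b : β) : PolyTime fun a => (f a).headD b := by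
  have := cases (h := fun q => q.1.1) hf (const b) (fst.comp fst)
  refine (congrArg PolyTime ?_).mp this
  funext a
  cases f a <;> rfl

theorem polyTime_tail {α β : Type} [DataRep α] [DataRep β] {f : α → List β} (hf : PolyTime f) :
    PolyTime fun a => (f a).tail := by
  have := cases (h := fun q => q.1.2) hf (const []) (snd.comp fst)
  refine (congrArg PolyTime ?_).mp this
  funext a
  cases f a <;> rfl

/-- The transitions of a machine, described by tokens. -/
abbrev TransTable : Type := List ((Token × Token) × (Token × Token))

/-- Letters with a number of occurrences that are still needed. -/
abbrev Need : Type := List (Token × Token)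

/-- The parts of an instance that the algorithm uses: the transitions, the start state, the input
word, and the census requirement. -/
def parts (p : List (List Token)) : (TransTable × Token) × (List Token × Need) :=
  ((pairUp (pairUp (p.tail.tail.tail.headD [])), (p.tail.headD []).headD []),
    (p.tail.tail.tail.tail.headD [], pairUp (p.tail.tail.tail.tail.tail.headD [])))

theorem polyTime_parts : PolyTime parts := by
  have h1 := polyTime_tail (β := List Token) PolyTime.id
  have h3 := polyTime_tail (polyTime_tail h1)
  have h4 := polyTime_tail h3
  have h5 := polyTime_tail h4
  exact ((polyTime_pairUp.comp (polyTime_pairUp.comp (polyTime_headD h3 []))).pair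
    (polyTime_headD (polyTime_headD h1 []) [])).pair
    ((polyTime_headD h4 []).pair (polyTime_pairUp.comp (polyTime_headD h5 [])))

/-- Subtract one from a number in binary. The symbol `comma` marks a negative result. -/
def dec : Token → Token
  | [] => [.comma]
  | .bit false :: t => .bit true :: dec t
  | .bit true :: t => .bit false :: t
  | s :: t => s :: t

theorem polyTime_dec : PolyTime dec := by
  -- The truth value is the borrow. The digits are collected in reverse; a borrow left at the end
  -- becomes the comma.
  let h : (Token × (Bool × Token)) × Sym → Bool × Token := fun p =>
    (bif p.1.2.1 then decide (p.2 = Sym.bit false) else false,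
      (bif p.1.2.1 then bif decide (p.2 = Sym.bit false) then Sym.bit true else
        bif decide (p.2 = Sym.bit true) then Sym.bit false else p.2 else p.2) :: p.1.2.2)
  have hh : PolyTime h := by
    have hb : PolyTime fun p : (Token × (Bool × Token)) × Sym => p.1.2.1 :=
      fst.comp (snd.comp fst)
    exact (hb.cond (snd.eq (const _)) (const false)).pair
      ((hb.cond ((snd.eq (const _)).cond (const _) ((snd.eq (const _)).cond (const _) snd))
        snd).cons (snd.comp (snd.comp fst)))
  have hG : Growth h := growth_of_le (k := fun p : Token × Sym => p) PolyTime.id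
    fun a s b => by
      simp only [h, repSize_pair, repSize_cons]
      have h1 := repSize_bool (bif s.1 then decide (b = Sym.bit false) else false)
      have h2 := repSize_sym (bif s.1 then bif decide (b = Sym.bit false) then Sym.bit true else
        bif decide (b = Sym.bit true) then Sym.bit false else b else b)
      have h3 := repSize_pos s.1
      have h4 := repSize_pos a
      have h5 := repSize_pos b
      have h6 : repSize s = repSize s.1 + repSize s.2 + 1 := rfl
      omega
  have hf := foldl PolyTime.id (const (true, [])) hh hG
  have h2 := reverse (((fst.comp hf).cond ((const Sym.comma).cons (snd.comp hf)) (snd.comp hf)))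
  refine (congrArg PolyTime ?_).mp h2
  funext t
  have h0 : ∀ w t out : Token, t.foldl (fun s b => h ((w, s), b)) (false, out) =
      (false, t.reverse ++ out) := by
    intro w t
    induction t with
    | nil => exact fun out => rfl
    | cons s t ih => intro out; simpa [h] using ih (s :: out)
  have h1 : ∀ w t out : Token, ∀ p, t.foldl (fun s b => h ((w, s), b)) (true, out) = p →
      (bif p.1 then Sym.comma :: p.2 else p.2).reverse = out.reverse ++ dec t := by
    intro w t
    induction t with
    | nil => rintro out p rfl; simp [dec]
    | cons s t ih =>
      rintro out p rfl
      rcases s with (_ | _) | _ | _ | _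
      · have := ih (.bit true :: out) _ rfl
        simpa [h, dec] using this
      all_goals
        refine (congrArg (fun p : Bool × Token =>
          (bif p.1 then Sym.comma :: p.2 else p.2).reverse) (h0 w t _)).trans ?_
        simp [dec]
  simpa using h1 t t [] _ rfl

/-- Account for an output letter. -/
def decNeed (b : Token) (r : Need) : Need :=
  r.map fun e => bif decide (e.1 = b) then (e.1, dec e.2) else e

/-- The successors of a configuration under an input letter. -/
def succs (T : TransTable) (a : Token) (c : Token × Need) : List (Token × Need) :=
  T.flatMap fun t => bif decide (t.1 = (c.1, a)) then [(t.2.1, decNeed t.2.2 c.2)] else []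

/-- Remove repetitions from a list. -/
def nodupList {α : Type} [DecidableEq α] (l : List α) : List α := l.foldr List.insert []

@[simp] theorem mem_nodupList {α : Type} [DecidableEq α] {l : List α} {a : α} :
    a ∈ nodupList l ↔ a ∈ l := by
  induction l with
  | nil => simp [nodupList]
  | cons b l ih =>
    rw [nodupList] at *
    simp [ih]

theorem nodup_nodupList {α : Type} [DecidableEq α] (l : List α) : (nodupList l).Nodup := by
  induction l with
  | nil => simp [nodupList]
  | cons b l ih => exact List.Nodup.insert ih

theorem polyTime_nodupList {α : Type} [DecidableEq α] [DataRep α] :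
    PolyTime (nodupList (α := α)) :=
  show PolyTime fun l : List α => l.foldr (fun b s => s.insert b) [] from
  foldr (h := fun p => p.1.2.insert p.2) PolyTime.id (const [])
    (PolyTime.insert snd (snd.comp fst))
    (growth_of_le (k := fun p : List α × α => p) PolyTime.id fun a s b => by
      by_cases hb : b ∈ s <;> simp [hb] <;> omega)

/-- The successors of a set of configurations under an input letter, without repetitions. -/
def stepSet (T : TransTable) (C : List (Token × Need)) (a : Token) : List (Token × Need) :=
  nodupList (C.flatMap (succs T a))

/-- All requirements are met. -/
def isMet (r : Need) : Bool := r.all fun e => e.2.all fun s => decide (s = Sym.bit false)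

theorem polyTime_decNeed : PolyTime fun p : Token × Need => decNeed p.1 p.2 :=
  map snd (((fst.comp snd).eq (fst.comp fst)).cond
    ((fst.comp snd).pair (polyTime_dec.comp (snd.comp snd))) snd)

theorem polyTime_succs :
    PolyTime fun p : (TransTable × Token) × (Token × Need) => succs p.1.1 p.1.2 p.2 := by
  refine flatMap (k := fun q : ((TransTable × Token) × (Token × Need)) ×
    ((Token × Token) × (Token × Token)) => bif decide (q.2.1 = (q.1.2.1, q.1.1.2)) then
      [(q.2.2.1, decNeed q.2.2.2 q.1.2.2)] else []) (fst.comp fst)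
        (((fst.comp snd).eq ((fst.comp (snd.comp fst)).pair
    (snd.comp (fst.comp fst)))).cond (((fst.comp (snd.comp snd)).pair ?_).cons (const []))
    (const []))
  exact polyTime_decNeed.comp ((snd.comp (snd.comp snd)).pair (snd.comp (snd.comp fst)))

theorem polyTime_stepSet :
    PolyTime fun p : (TransTable × List (Token × Need)) × Token => stepSet p.1.1 p.1.2 p.2 := by
  have h1 : PolyTime fun p : (TransTable × List (Token × Need)) × Token =>
      p.1.2.flatMap (succs p.1.1 p.2) :=
    flatMap (snd.comp fst) (polyTime_succs.comp
      (((fst.comp (fst.comp fst)).pair (snd.comp fst)).pair snd))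
  exact polyTime_nodupList.comp h1

theorem polyTime_isMet : PolyTime isMet :=
  all PolyTime.id (all (snd.comp snd) (snd.eq (const _)))

end GWMMInstance

namespace GWMMInstance

/-! ### Correctness of the algorithm -/

/-- `TableRun T p x y q`: in the table `T`, a sequence of transitions leads from `p` to `q`, with
input `x` and output `y`. -/
inductive TableRun (T : TransTable) : Token → List Token → List Token → Token → Prop
  | nil (p : Token) : TableRun T p [] [] p
  | cons {p q r a b : Token} {x y : List Token} :
      ((p, a), (q, b)) ∈ T → TableRun T q x y r → TableRun T p (a :: x) (b :: y) r

theorem TableRun.length_eq {T : TransTable} {p q : Token} {x y : List Token}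
    (h : TableRun T p x y q) : y.length = x.length := by
  induction h with
  | nil p => rfl
  | cons _ _ ih => simp [ih]

/-- A run ends either where it starts or in a state that is written in the table. -/
theorem TableRun.repSize_le {T : TransTable} {p q : Token} {x y : List Token}
    (h : TableRun T p x y q) : q = p ∨ repSize q ≤ repSize T := by
  induction h with
  | nil p => exact .inl rfl
  | @cons p q r a b x y ht hr ih =>
    rcases ih with rfl | ih
    · have := repSize_le_of_mem ht
      simp only [repSize_pair] at this
      omega
    · exact .inr ih

theorem TableRun.eq_of_nil {T : TransTable} {p q : Token} {y : List Token}
    (h : TableRun T p [] y q) : y = [] ∧ q = p := by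
  cases h
  exact ⟨rfl, rfl⟩

/-- The requirements that are left when letters have been output the given numbers of times. -/
def needAfter (r : Need) (j : Token → ℕ) : Need := r.map fun e => (e.1, dec^[j e.1] e.2)

theorem needAfter_decNeed (r : Need) (b : Token) (y : List Token) :
    needAfter (decNeed b r) (fun t => y.count t) = needAfter r fun t => (b :: y).count t := by
  simp only [needAfter, decNeed, List.map_map]
  refine List.map_congr_left fun e _ => ?_
  by_cases h : e.1 = b
  · simp [h]
  · simp [h, Ne.symm h]

theorem mem_stepSet {T : TransTable} {C : List (Token × Need)} {a : Token} {c : Token × Need} :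
    c ∈ stepSet T C a ↔ ∃ d ∈ C, ∃ q b, ((d.1, a), (q, b)) ∈ T ∧ c = (q, decNeed b d.2) := by
  simp only [stepSet, succs, mem_nodupList, List.mem_flatMap]
  refine exists_congr fun d => and_congr_right fun _ => ?_
  constructor
  · rintro ⟨⟨⟨p, a'⟩, q, b⟩, ht, hc⟩
    by_cases h : (p, a') = (d.1, a)
    · simp only [h, decide_true, cond_true, List.mem_singleton] at hc
      exact ⟨q, b, h ▸ ht, hc⟩
    · simp [h] at hc
  · rintro ⟨q, b, ht, rfl⟩
    exact ⟨_, ht, by simp⟩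

/-- The invariant of the search. A configuration forgets the output itself: the remaining
requirements depend on it through its letter counts only. -/
theorem mem_foldl_stepSet {T : TransTable} {x : List Token} {C : List (Token × Need)}
    {c : Token × Need} : c ∈ x.foldl (stepSet T) C ↔
      ∃ d ∈ C, ∃ y, TableRun T d.1 x y c.1 ∧ c.2 = needAfter d.2 fun t => y.count t := by
  induction x generalizing C with
  | nil =>
    constructor
    · exact fun h => ⟨c, h, [], .nil _, by simp [needAfter]⟩
    · rintro ⟨d, hd, y, hy, hc⟩
      obtain ⟨rfl, h⟩ := hy.eq_of_nil
      have e : needAfter d.2 (fun t => List.count t []) = d.2 := by simp [needAfter]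
      rwa [show c = d from Prod.ext h (hc.trans e)]
  | cons a x ih =>
    rw [List.foldl_cons, ih]
    constructor
    · rintro ⟨d, hd, y, hr, hc⟩
      obtain ⟨d', hd', q, b, ht, rfl⟩ := mem_stepSet.1 hd
      exact ⟨d', hd', b :: y, .cons ht hr, by rw [hc, needAfter_decNeed]⟩
    · rintro ⟨d, hd, y, hr, hc⟩
      cases hr with
      | @cons _ q _ _ b _ y ht hr =>
        exact ⟨(q, decNeed b d.2), mem_stepSet.2 ⟨d, hd, q, b, ht, rfl⟩, y, hr,
          by rw [hc, needAfter_decNeed]⟩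

theorem nodup_foldl_stepSet {T : TransTable} {x : List Token} {C : List (Token × Need)}
    (hC : C.Nodup) : (x.foldl (stepSet T) C).Nodup := by
  induction x generalizing C with
  | nil => exact hC
  | cons a x ih => exact ih (nodup_nodupList _)

/-- Leading zeros are never removed, so a token need not be canonical; the statement is therefore
about values. -/
theorem dec_spec {t : Token} (ht : ∀ s ∈ t, ∃ b, s = Sym.bit b) :
    (tokenVal t = 0 → Sym.comma ∈ dec t) ∧ (tokenVal t ≠ 0 →
      (∀ s ∈ dec t, ∃ b, s = Sym.bit b) ∧ tokenVal (dec t) + 1 = tokenVal t) := by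
  induction t with
  | nil => simp [dec, tokenVal]
  | cons s t ih =>
    obtain ⟨b, rfl⟩ := ht s (by simp)
    have ht' : ∀ s ∈ t, ∃ b, s = Sym.bit b := fun s hs => ht s (by simp [hs])
    obtain ⟨h1, h2⟩ := ih ht'
    cases b with
    | false =>
      refine ⟨fun h => ?_, fun h => ?_⟩
      · simp [dec, h1 (by simpa [tokenVal] using h)]
      · obtain ⟨h3, h4⟩ := h2 (by simpa [tokenVal] using h)
        refine ⟨by simpa [dec] using h3, ?_⟩
        simp [dec, tokenVal]
        omega
    | true =>
      refine ⟨fun h => by simp [tokenVal] at h, fun h => ⟨by simpa [dec] using ht', ?_⟩⟩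
      simp [dec, tokenVal]
      omega

theorem comma_mem_dec {t : Token} (h : Sym.comma ∈ t) : Sym.comma ∈ dec t := by
  induction t with
  | nil => simp [dec]
  | cons s t ih => rcases s with (_ | _) | _ | _ | _ <;> simp_all [dec]

/-- With fewer decrements than the value a true bit remains. The first decrement beyond zero leaves
a comma, which all later ones preserve by `comma_mem_dec`. -/
theorem all_dec_iterate {t : Token} (ht : ∀ s ∈ t, ∃ b, s = Sym.bit b) (j : ℕ) :
    ((dec^[j] t).all fun s => decide (s = Sym.bit false)) = true ↔ j = tokenVal t := by
  induction j generalizing t with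
  | zero =>
    induction t with
    | nil => simp [tokenVal]
    | cons s t ih =>
      have ht' : ∀ s ∈ t, ∃ b, s = Sym.bit b := fun s hs => ht s (by simp [hs])
      obtain ⟨_ | _, rfl⟩ := ht s (by simp)
      · have := ih ht'
        simp only [Function.iterate_zero, id] at *
        simp only [List.all_cons, decide_true, Bool.true_and, this, tokenVal]
        simp [eq_comm]
      · simp [tokenVal]
        omega
  | succ j ih =>
    rw [Function.iterate_succ_apply]
    obtain ⟨h1, h2⟩ := dec_spec ht
    by_cases h : tokenVal t = 0
    · have : Sym.comma ∈ dec^[j] (dec t) := by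
        exact Function.Iterate.rec (fun t => Sym.comma ∈ t) (h1 h) (fun _ => comma_mem_dec) j
      have h4 : ((dec^[j] (dec t)).all fun s => decide (s = Sym.bit false)) ≠ true := fun h' => by
        simpa using List.all_eq_true.1 h' _ this
      simp [h4, h]
    · obtain ⟨h3, h4⟩ := h2 h
      rw [ih h3]
      omega

theorem natToken_bits (n : ℕ) : ∀ s ∈ natToken n, ∃ b, s = Sym.bit b := fun s hs => by
  obtain ⟨b, _, rfl⟩ := List.mem_map.1 hs
  exact ⟨b, rfl⟩

/-- The table of the transitions of a machine. -/
def table (M : MealyMachine) : TransTable := (listing (transitions M)).map fun t =>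
  ((natToken t.1.1, letterToken t.1.2), (natToken t.2.1, letterToken t.2.2))

/-- The census requirement of an instance. -/
def need (I : GWMMInstance) : Need := (listing Finset.univ).map fun b =>
  (letterToken b.1.1, natToken (I.census b))

/-- The input word of an instance. -/
def wordTokens (I : GWMMInstance) : List Token := I.word.map fun a => letterToken a.1

@[simp] theorem mem_listing {α : Type} [Encodable α] {s : Finset α} {a : α} :
    a ∈ listing s ↔ a ∈ s := by simp [listing]

theorem mem_table {M : MealyMachine} {p a q b : Token} : ((p, a), (q, b)) ∈ table M ↔
    ∃ p' a' q' b', (q', b') ∈ M.trans (p', a') ∧ p = natToken p' ∧ a = letterToken a'.1 ∧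
      q = natToken q' ∧ b = letterToken b'.1 := by
  simp only [table, List.mem_map, mem_listing, transitions, Finset.mem_filter, Finset.mem_univ,
    true_and, Prod.mk.injEq]
  constructor
  · rintro ⟨⟨⟨p', a'⟩, q', b'⟩, h, ⟨rfl, rfl⟩, rfl, rfl⟩
    exact ⟨p', a', q', b', h, rfl, rfl, rfl, rfl⟩
  · rintro ⟨p', a', q', b', h, rfl, rfl, rfl, rfl⟩
    exact ⟨⟨⟨p', a'⟩, q', b'⟩, h, ⟨rfl, rfl⟩, rfl, rfl⟩

theorem tableRun_table {M : MealyMachine} {p : M.states} {x : List M.inputs} {y : List Token}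
    {q : Token} : TableRun (table M) (natToken p) (x.map fun a => letterToken a.1) y q ↔
      ∃ z q', M.Run p x z q' ∧ y = z.map (fun b => letterToken b.1) ∧ q = natToken q' := by
  constructor
  · intro h
    generalize hp : natToken p = p₀ at h
    generalize hx : x.map (fun a => letterToken a.1) = x₀ at h
    induction h generalizing p x with
    | nil p₀ =>
      obtain rfl : x = [] := List.map_eq_nil_iff.1 hx
      exact ⟨[], p, .nil p, rfl, hp.symm⟩
    | @cons p₁ q₁ r a b x₁ y₁ ht hr ih =>
      obtain ⟨a₂, x₂, rfl, ha, hx'⟩ := List.map_eq_cons_iff.1 hx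
      obtain ⟨p', a', q', b', h, rfl, rfl, rfl, rfl⟩ := mem_table.1 ht
      obtain ⟨z, q'', hz, rfl, rfl⟩ := ih rfl hx'
      -- Distinct states and letters have distinct tokens, so consecutive table entries fit together
      -- in the machine as well.
      obtain rfl : p = p' := Subtype.ext (natToken_injective hp)
      obtain rfl : a₂ = a' := Subtype.ext (letterToken_injective ha)
      exact ⟨b' :: z, q'', .cons h hz, rfl, rfl⟩
  · rintro ⟨z, q', h, rfl, rfl⟩
    induction h with
    | nil p => exact .nil _
    | @cons p q r a b u y ht _ ih =>
      exact .cons (mem_table.2 ⟨p, a, q, b, ht, rfl, rfl, rfl, rfl⟩) ih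

/-- This is where the exclusion of the empty input letter enters: no transition can be inserted
without reading a letter, so a computation on a word reads exactly this sequence. -/
theorem spell_injective {A : Finset Letter} (hA : none ∉ A) :
    Function.Injective (MealyMachine.spell (A := A)) := by
  have key : ∀ u : List A, (MealyMachine.spell u).map some = u.map Subtype.val := by
    intro u
    induction u with
    | nil => rfl
    | cons a u ih =>
      obtain ⟨_ | a, ha⟩ := a
      · exact absurd ha hA
      · simp only [MealyMachine.spell, List.map_cons, List.reduceOption_cons_of_some] at *
        rw [ih]
  intro u v h
  have := (key u).symm.trans ((congrArg (List.map some) h).trans (key v))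
  exact List.map_injective_iff.2 Subtype.val_injective this

/-- Some configuration in the set meets all requirements. -/
def accepts (C : List (Token × Need)) : Bool := C.any fun c => isMet c.2

theorem accepts_iff (I : GWMMInstance) (hI : (none : Letter) ∉ I.machine.inputs) :
    accepts ((wordTokens I).foldl (stepSet (table I.machine))
      [(natToken I.machine.start, need I)]) = true ↔ varGWMM.Yes I := by
  have count (z : List I.machine.outputs) (b : I.machine.outputs) :
      (z.map fun b => letterToken b.1).count (letterToken b.1) = z.count b :=
    List.count_map_of_injective z (fun b : I.machine.outputs => letterToken b.1)
      (letterToken_injective.comp Subtype.val_injective) b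
  have met (z : List I.machine.outputs) : isMet (needAfter (need I) fun t =>
      (z.map fun b => letterToken b.1).count t) = true ↔ I.machine.Meets z I.census := by
    simp only [isMet, needAfter, need, List.map_map, List.all_map, List.all_eq_true, mem_listing,
      Finset.mem_univ, true_imp_iff, MealyMachine.Meets, Function.comp]
    refine forall_congr' fun b => ?_
    have := all_dec_iterate (natToken_bits (I.census b)) (z.count b.1)
    rw [tokenVal_natToken] at this
    rw [← this, count]
    simp [List.all_eq_true]
  simp only [accepts, List.any_eq_true, mem_foldl_stepSet, List.mem_singleton]
  constructor
  · rintro ⟨c, ⟨_, rfl, y, hr, hc⟩, hm⟩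
    obtain ⟨z, q, hz, rfl, hq⟩ := tableRun_table.1 hr
    rw [hc] at hm
    exact ⟨z, ⟨I.word, q, rfl, hz⟩, (met z).1 hm⟩
  · rintro ⟨z, ⟨u, q, hu, hz⟩, hm⟩
    obtain rfl := spell_injective hI hu
    exact ⟨(natToken q, _), ⟨_, rfl, _, tableRun_table.2 ⟨z, q, hz, rfl, rfl⟩, rfl⟩, (met z).2 hm⟩

/-- The start state has a comma but no hash of its own, so its token becomes the first one in the
section of the input alphabet. A transition consists of four consecutive tokens and is restored by
pairing twice. -/
theorem parts_parse_encode (I : GWMMInstance) : parts (parse I.encode) =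
    ((table I.machine, natToken I.machine.start), (wordTokens I, need I)) := by
  obtain ⟨M, x, c⟩ := I
  have hn : ∀ n, encodeNat n = [natToken n].flatMap (· ++ [Sym.comma]) := by simp [encodeNat_eq]
  have hl : ∀ a, encodeLetter a = [letterToken a].flatMap (· ++ [Sym.comma]) := by
    simp [encodeLetter_eq]
  have h6 := parse_encodeList (e := fun b => encodeLetter b.1.1 ++ encodeNat (c b))
    (toks := fun b => [letterToken b.1.1, natToken (c b)]) (listing Finset.univ)
    (fun b => by simp [hn, hl]) (fun b t ht => by
      simp only [List.mem_cons, List.not_mem_nil, or_false] at ht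
      rcases ht with rfl | rfl
      exacts [letterToken_clean _, natToken_clean _]) []
  have h5 := parse_encodeList (e := fun a => encodeLetter a.1) (toks := fun a => [letterToken a.1])
    x (fun a => hl _) (fun a t ht => List.mem_singleton.1 ht ▸ letterToken_clean _)
    (encodeList (fun b => encodeLetter b.1.1 ++ encodeNat (c b)) (listing Finset.univ) ++ [])
  have h4 := parse_encodeList (e := fun t => encodeNat t.1.1 ++ encodeLetter t.1.2 ++
      encodeNat t.2.1 ++ encodeLetter t.2.2) (toks := fun t => [natToken t.1.1,
      letterToken t.1.2, natToken t.2.1, letterToken t.2.2]) (listing (transitions M))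
    (fun b => by simp [hn, hl]) (fun b t ht => by
      simp only [List.mem_cons, List.not_mem_nil, or_false] at ht
      rcases ht with rfl | rfl | rfl | rfl
      exacts [natToken_clean _, letterToken_clean _, natToken_clean _, letterToken_clean _])
    (encodeList (fun a => encodeLetter a.1) x ++ (encodeList (fun b =>
      encodeLetter b.1.1 ++ encodeNat (c b)) (listing Finset.univ) ++ []))
  have h3 := parse_encodeList (e := encodeLetter) (toks := fun a => [letterToken a])
    (listing M.outputs) hl (fun a t ht => List.mem_singleton.1 ht ▸ letterToken_clean _)
  have h2 := parse_encodeList (e := encodeLetter) (toks := fun a => [letterToken a])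
    (listing M.inputs) hl (fun a t ht => List.mem_singleton.1 ht ▸ letterToken_clean _)
  have h0 := parse_encodeList (e := fun s : ℕ => encodeNat s) (toks := fun s => [natToken s])
    (listing M.states) hn (fun a t ht => List.mem_singleton.1 ht ▸ natToken_clean _)
  have e : encode ⟨M, x, c⟩ = encodeList (fun s => encodeNat s) (listing M.states) ++
      (natToken M.start ++ Sym.comma :: (encodeList encodeLetter (listing M.inputs) ++
      (encodeList encodeLetter (listing M.outputs) ++ (encodeList (fun t =>
      encodeNat t.1.1 ++ encodeLetter t.1.2 ++ encodeNat t.2.1 ++ encodeLetter t.2.2)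
      (listing (transitions M)) ++ (encodeList (fun a => encodeLetter a.1) x ++
      (encodeList (fun b => encodeLetter b.1.1 ++ encodeNat (c b))
        (listing Finset.univ) ++ [])))))) := by
    simp [encode, encodeNat_eq]
  rw [e, h0, parse_token (natToken_clean _) (h2 _), h3, h4, h5, h6]
  have p1 := pairUp_flatMap (fun b : {b : M.outputs // b.1 ≠ none} => letterToken b.1.1)
    (fun b => natToken (c b)) (listing Finset.univ)
  have p2 : pairUp (pairUp ((listing (transitions M)).flatMap fun t => [natToken t.1.1,
      letterToken t.1.2, natToken t.2.1, letterToken t.2.2])) = table M := by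
    have e1 := pairUp_flatMap Prod.fst Prod.snd ((listing (transitions M)).flatMap fun t =>
      [((natToken t.1.1 : Token), letterToken t.1.2), (natToken t.2.1, letterToken t.2.2)])
    rw [List.flatMap_assoc] at e1
    simp only [List.flatMap_cons, List.flatMap_nil, List.append_nil, List.cons_append,
      List.nil_append, Prod.mk.eta, List.map_id'] at e1
    rw [e1, pairUp_flatMap]
    rfl
  have p3 : x.flatMap (fun a => [letterToken a.1]) = x.map fun a => letterToken a.1 :=
    List.map_eq_flatMap.symm
  simp only [parts, List.tail_cons, List.headD_cons, p1, p2, p3, wordTokens, need]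

end GWMMInstance

namespace GWMMInstance

/-! ### The running time -/

theorem length_dec_le (t : Token) : (dec t).length ≤ t.length + 1 := by
  induction t with
  | nil => simp [dec]
  | cons s t ih => rcases s with (_ | _) | _ | _ | _ <;> simp [dec, ih]

/-- A decrement lengthens a token by at most one symbol, and each symbol of a list takes up at most
8 in its tree. -/
theorem repSize_dec_iterate (t : Token) (j : ℕ) :
    repSize (dec^[j] t) ≤ (repSize t + j) * 8 + 1 := by
  have h1 : ∀ j, (dec^[j] t).length ≤ t.length + j := by
    intro j
    induction j with
    | zero => simp
    | succ j ih =>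
      rw [Function.iterate_succ_apply']
      have := length_dec_le (dec^[j] t)
      omega
  have h2 := repSize_list_le (l := dec^[j] t) (B := 7) fun s _ => repSize_sym s
  have := h1 j
  have := length_le_repSize t
  omega

theorem repSize_needAfter_le (r : Need) {j : Token → ℕ} {n : ℕ} (hj : ∀ t, j t ≤ n) :
    repSize (needAfter r j) ≤ repSize r * (9 * repSize r + 8 * n + 3) + 1 := by
  have h := repSize_list_le (l := needAfter r j) (B := 9 * repSize r + 8 * n + 2) (by
    intro e he
    obtain ⟨e, he', rfl⟩ := List.mem_map.1 he
    have h1 := repSize_le_of_mem he'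
    have h2 := repSize_dec_iterate e.2 (j e.1)
    have h3 := hj e.1
    have h4 : repSize e = repSize e.1 + repSize e.2 + 1 := rfl
    simp only [repSize_pair]
    omega)
  refine h.trans (Nat.add_le_add_right (Nat.mul_le_mul_right _ ?_) 1)
  simpa [needAfter] using length_le_repSize r

/-- The number of pairs of a state and a vector of numbers up to `n`, indexed by the output
letters. -/
def configBound (M : MealyMachine) (n : ℕ) : ℕ := M.states.card * (n + 1) ^ M.outputs.card

/-- Every stored configuration is determined by a state and by the count of each output letter. The
counts are at most the length of the word, since one letter, possibly empty, is output per
transition. As the list has no repetitions, its length is at most the number of such pairs. -/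
theorem length_foldl_stepSet_le (I : GWMMInstance) {l : List Token} (hl : l <+: wordTokens I) :
    (l.foldl (stepSet (table I.machine)) [(natToken I.machine.start, need I)]).length ≤
      configBound I.machine I.word.length := by
  classical
  obtain ⟨M, x, c⟩ := I
  -- The vector also has a coordinate for the empty letter, if that is an output letter; `g` ignores
  -- it, which only enlarges the bound.
  let g : M.states × (M.outputs → Fin (x.length + 1)) → Token × Need := fun p =>
    (natToken p.1, (listing Finset.univ).map fun b : {b : M.outputs // b.1 ≠ none} =>
      (letterToken b.1.1, dec^[p.2 b.1] (natToken (c b))))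
  have hx : l.length ≤ x.length := by simpa [wordTokens] using hl.length_le
  obtain ⟨u, hu⟩ : ∃ u : List M.inputs, l = u.map fun a => letterToken a.1 := by
    obtain ⟨k, rfl⟩ : ∃ k, l = (wordTokens ⟨M, x, c⟩).take k := ⟨_, List.prefix_iff_eq_take.1 hl⟩
    exact ⟨x.take k, by simp [wordTokens, List.map_take]⟩
  have hsub : (l.foldl (stepSet (table M)) [(natToken M.start, need ⟨M, x, c⟩)]).toFinset ⊆
      Finset.univ.image g := by
    intro d hd
    rw [List.mem_toFinset, mem_foldl_stepSet] at hd
    obtain ⟨e, he, y, hr, hd⟩ := hd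
    rw [List.mem_singleton] at he
    subst he
    have hlen := hr.length_eq
    simp only at hr hd
    rw [hu] at hr
    obtain ⟨z, q, hz, rfl, hq⟩ := tableRun_table.1 hr
    refine Finset.mem_image.2 ⟨(q, fun b => ⟨(z.map fun b => letterToken b.1).count
      (letterToken b.1), ?_⟩), Finset.mem_univ _, ?_⟩
    · have := List.count_le_length (a := letterToken b.1) (l := z.map fun b => letterToken b.1)
      omega
    · refine Prod.ext hq.symm ?_
      rw [hd]
      simp [g, needAfter, need]
  have hnd := nodup_foldl_stepSet (T := table M) (x := l)
    (List.nodup_singleton (natToken M.start, need ⟨M, x, c⟩))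
  rw [← List.toFinset_card_of_nodup hnd]
  refine (Finset.card_le_card hsub).trans (Finset.card_image_le.trans (le_of_eq ?_))
  simp [configBound]

/-- The size of the sets that the algorithm computes. -/
theorem repSize_foldl_stepSet_le (I : GWMMInstance) {l : List Token} (hl : l <+: wordTokens I) :
    repSize (l.foldl (stepSet (table I.machine)) [(natToken I.machine.start, need I)]) ≤
      configBound I.machine I.word.length * (repSize (parts (parse I.encode)) +
        (repSize (parts (parse I.encode)) * (17 * repSize (parts (parse I.encode)) + 3) + 3)) +
        1 := by
  have hP : repSize (parts (parse I.encode)) = repSize (table I.machine) +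
      repSize (natToken I.machine.start) + repSize (wordTokens I) + repSize (need I) + 3 := by
    rw [parts_parse_encode]
    simp only [repSize_pair]
    omega
  set P := repSize (parts (parse I.encode))
  refine (repSize_list_le (B := P + (P * (17 * P + 3) + 1) + 1) fun d hd => ?_).trans
    (Nat.add_le_add_right (Nat.mul_le_mul (length_foldl_stepSet_le I hl) (by omega)) 1)
  obtain ⟨e, he, y, hr, hd⟩ := mem_foldl_stepSet.1 hd
  rw [List.mem_singleton] at he
  subst he
  -- No letter count exceeds the length of the word and hence `P`; the factor 17 below is 9 + 8
  -- after both bounds are replaced by `P`.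
  have h1 := repSize_needAfter_le (need I) (j := fun t => y.count t) (n := P) fun t => by
    have := List.count_le_length (a := t) (l := y)
    have := hr.length_eq
    have := hl.length_le
    have := length_le_repSize (wordTokens I)
    omega
  have h2 : repSize (need I) * (9 * repSize (need I) + 8 * P + 3) ≤ P * (17 * P + 3) :=
    Nat.mul_le_mul (by omega) (by omega)
  have h3 : repSize d.1 ≤ P := by
    rcases hr.repSize_le with h | h
    · rw [h]
      change repSize (natToken I.machine.start) ≤ P
      omega
    · omega
  have h4 : repSize d = repSize d.1 + repSize d.2 + 1 := rfl
  rw [h4, hd]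
  simp only at *
  omega

end GWMMInstance

/-! ### The machine -/

namespace Prog

open StackCmd GWMMInstance

/-- Push a word on the main stack. -/
def pushWord : List Bool → Prog
  | [] => .skip
  | a :: l => .seq (pushWord l) (.push .main a)

theorem runs_pushWord (i : List Sym) (l m q r c f : List Bool) :
    Runs (pushWord l) (store i m q r c f) (store i (l ++ m) q r c f) (l.length + 1) := by
  induction l with
  | nil => exact runs_skip
  | cons a l ih => exact (ih.seq runs_push_main).mono (by simp)

/-- Read the input, and write it to the main stack as the tree of the reversed list. -/
def readInput : Prog := .seq (.push .main false) (.loop .inp fun s =>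
  .seq (pushWord (DataRep.toData s).enc) (.push .main true))

theorem runs_readInput (w : List Sym) : Runs readInput (store w [] [] [] [] [])
    (store [] (DataRep.toData w.reverse).enc [] [] [] []) (10 * w.length + 2) := by
  have key : ∀ w l : List Sym, Runs (.loop .inp fun s =>
      .seq (pushWord (DataRep.toData s).enc) (.push .main true))
      (store w (DataRep.toData l).enc [] [] [] [])
      (store [] (DataRep.toData (w.reverse ++ l)).enc [] [] [] []) (10 * w.length + 1) := by
    intro w
    induction w with
    | nil => exact fun l => runs_loop_nil rfl
    | cons s w ih =>
      intro l
      have h1 := repSize_sym s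
      have h2 := ih (s :: l)
      rw [List.reverse_cons, List.append_assoc, List.singleton_append]
      refine (runs_loop_inp ((runs_pushWord ..).seq runs_push_main) h2).mono ?_
      simp only [Data.length_enc, List.length_cons]
      unfold repSize at h1
      omega
  have := key w []
  rw [List.append_nil] at this
  exact (runs_push_main.seq this).mono (by omega)

/-- Move a truth value from the main stack to the output stack. -/
def writeOutput : Prog := .pop .main fun o => match o with
  | some true => .pop .main fun _ => .pop .main fun _ => .push .out true
  | _ => .push .out false

theorem runs_writeOutput (b : Bool) : Runs writeOutput
    (store [] (DataRep.toData b).enc [] [] [] []) (Function.update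
      (fun k => ([] : List (StkAlph k))) Stk.out [b]) 4 := by
  have e : Function.update (store [] [] [] [] [] []) Stk.out [b] =
      Function.update (fun k => ([] : List (StkAlph k))) Stk.out [b] := by
    funext k; cases k <;> rfl
  cases b with
  | false => exact Runs.mono (t := 2) (runs_pop_main (a := false) (runs_push e)) (by omega)
  | true =>
    exact runs_pop_main (a := true) (runs_pop_main (a := false)
      (runs_pop_main (a := false) (runs_push e)))

end Prog

/-- Each letter of the word contributes at least its comma, and each of the six lists contributes a
hash. -/
theorem GWMMInstance.word_length_le_size (I : GWMMInstance) :
    I.word.length + 6 ≤ I.encode.length := by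
  have h : ∀ (α : Type) (e : α → List Sym) (l : List α), 1 ≤ (encodeList e l).length := by
    intro α e l; simp [encodeList]
  have h' : ∀ l : List I.machine.inputs,
      l.length + 1 ≤ (encodeList (fun a => encodeLetter a.1) l).length := by
    intro l
    simp only [encodeList, List.length_append, List.length_flatMap, List.length_singleton,
      Nat.add_le_add_iff_right]
    induction l with
    | nil => simp
    | cons a l ih =>
      simp only [List.length_cons, List.map_cons, List.sum_cons, encodeLetter_eq,
        List.length_append] at *
      omega
  simp only [encode, List.length_append]
  have h1 := h' I.word
  have h2 := h _ (fun s : ℕ => encodeNat s) (listing I.machine.states)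
  have h3 := h _ encodeLetter (listing I.machine.inputs)
  have h4 := h _ encodeLetter (listing I.machine.outputs)
  have h5 := h _ (fun t : (I.machine.states × I.machine.inputs) ×
    (I.machine.states × I.machine.outputs) => encodeNat t.1.1 ++ encodeLetter t.1.2 ++
    encodeNat t.2.1 ++ encodeLetter t.2.2) (listing (transitions I.machine))
  have h6 := h _ (fun b : {b : I.machine.outputs // b.1 ≠ none} =>
    encodeLetter b.1.1 ++ encodeNat (I.census b)) (listing Finset.univ)
  omega

namespace GWMMInstance

/-- The algorithm on the parts of an instance. -/
def solve (p : (TransTable × Token) × (List Token × Need)) : List (Token × Need) :=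
  p.2.1.foldl (stepSet p.1.1) [(p.1.2, p.2.2)]

/-- The fold over the input word has no polynomial growth bound, hence the budget `B`, which is
later supplied by counting configurations. -/
theorem exists_prog_solve : ∃ (c : Prog) (e : ℕ), ∀ p B,
    (∀ l, l <+: p.2.1 → repSize (l.foldl (stepSet p.1.1) [(p.1.2, p.2.2)]) ≤ B) →
      c.Computes (DataRep.toData p) (DataRep.toData (solve p)) ((repSize p + B + 2) ^ e) := by
  have hg : PolyTime fun p : (TransTable × Token) × (List Token × Need) => [(p.1.2, p.2.2)] :=
    ((PolyTime.snd.comp PolyTime.fst).pair (PolyTime.snd.comp PolyTime.snd)).cons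
      (PolyTime.const [])
  have hp : PolyTime fun q : (((TransTable × Token) × (List Token × Need)) ×
      List (Token × Need)) × Token => ((q.1.1.1.1, q.1.2), q.2) :=
    ((PolyTime.fst.comp (PolyTime.fst.comp (PolyTime.fst.comp
      PolyTime.fst))).pair (PolyTime.snd.comp PolyTime.fst)).pair PolyTime.snd
  have hh := polyTime_stepSet.comp hp
  obtain ⟨c, e, H⟩ := PolyTime.foldl_budget (PolyTime.fst.comp PolyTime.snd) hg hh
  exact ⟨c, e, fun p B h => H p B h⟩

theorem polyTime_accepts : PolyTime accepts :=
  PolyTime.any PolyTime.id (polyTime_isMet.comp (PolyTime.snd.comp PolyTime.snd))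

/-- A program that solves the problem, with a bound on its running time. -/
theorem exists_prog : ∃ (c : Prog) (e : ℕ), ∀ I : GWMMInstance,
    c.Runs (Function.update (fun k => ([] : List (StkAlph k))) Stk.inp I.encode)
      (Function.update (fun k => ([] : List (StkAlph k))) Stk.out
        [accepts (solve (parts (parse I.encode)))])
      ((I.encode.length + configBound I.machine I.encode.length + 2) ^ e) := by
  have hparts := polyTime_parts.comp polyTime_parse
  obtain ⟨es, hs⟩ := hparts.size_le
  obtain ⟨c1, e1, h1⟩ := hparts
  obtain ⟨c2, e2, h2⟩ := exists_prog_solve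
  obtain ⟨c3, e3, h3⟩ := polyTime_accepts
  have hp (k : ℕ) : PolyBound fun n => (n + 2) ^ k := (PolyBound.id.add (.const 2)).pow k
  obtain ⟨ep, hep⟩ := (hp es).comp ((PolyBound.id.mul (.const 8)).add (.const 1))
  obtain ⟨eb, heb⟩ := (PolyBound.id.mul ((hp ep).add (((hp ep).mul
    (((PolyBound.const 17).mul (hp ep)).add (.const 3))).add (.const 3)))).add (.const 1)
  obtain ⟨e, he⟩ := (((PolyBound.const 10).mul .id).add (.const 2)).add
    (((((hp e1).comp ((PolyBound.id.mul (.const 8)).add (.const 1))).add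
    (((hp e2).comp ((hp ep).add (hp eb))).add ((hp e3).comp (hp eb))))).add (.const 4))
  refine ⟨.seq Prog.readInput (.seq (.seq c1 (.seq c2 c3)) Prog.writeOutput), e, fun I => ?_⟩
  -- All running times are bounded by polynomials in the single quantity `V`, with exponents that do
  -- not depend on the instance; the parameter enters only through `configBound`.
  set V := I.encode.length + configBound I.machine I.encode.length with hV
  have hlen : repSize I.encode.reverse ≤ V * 8 + 1 := by
    have := repSize_list_le (l := I.encode.reverse) (B := 7) fun s _ => repSize_sym s
    rw [List.length_reverse] at this
    omega
  have hPI : repSize (parts (parse I.encode)) ≤ (V + 2) ^ ep := by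
    have := hs I.encode.reverse
    simp only [List.reverse_reverse] at this
    exact this.trans ((Nat.pow_le_pow_left (by omega) es).trans (hep V))
  have hfold : ∀ l, l <+: (parts (parse I.encode)).2.1 →
      repSize (l.foldl (stepSet (parts (parse I.encode)).1.1)
        [((parts (parse I.encode)).1.2, (parts (parse I.encode)).2.2)]) ≤ (V + 2) ^ eb := by
    intro l hl
    have h := repSize_foldl_stepSet_le I (l := l) (by simpa [parts_parse_encode] using hl)
    have hc : configBound I.machine I.word.length ≤ V := by
      have : configBound I.machine I.word.length ≤ configBound I.machine I.encode.length :=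
        Nat.mul_le_mul_left _ (Nat.pow_le_pow_left (by
          have := I.word_length_le_size; omega) _)
      omega
    refine le_trans ?_ ((h.trans ?_).trans (heb V))
    · rw [parts_parse_encode]
    · change _ ≤ V * ((V + 2) ^ ep + ((V + 2) ^ ep * (17 * (V + 2) ^ ep + 3) + 3)) + 1
      gcongr
  have r0 := Prog.runs_readInput I.encode
  have r1 := h1 I.encode.reverse
  simp only [List.reverse_reverse] at r1
  have r2 := h2 (parts (parse I.encode)) _ hfold
  have r3 := h3 (solve (parts (parse I.encode)))
  have r4 := (r1.comp (r2.comp r3)) []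
  simp only [List.append_nil] at r4
  have e0 : Function.update (fun k => ([] : List (StkAlph k))) Stk.inp I.encode =
      store I.encode [] [] [] [] [] := by
    funext k; cases k <;> rfl
  rw [e0]
  refine (r0.seq (r4.seq (Prog.runs_writeOutput _))).mono (le_trans ?_ (he V))
  have b1 : (repSize I.encode.reverse + 2) ^ e1 ≤ (V * 8 + 1 + 2) ^ e1 :=
    Nat.pow_le_pow_left (by omega) _
  have b2 : (repSize (parts (parse I.encode)) + (V + 2) ^ eb + 2) ^ e2 ≤
      ((V + 2) ^ ep + (V + 2) ^ eb + 2) ^ e2 := Nat.pow_le_pow_left (by omega) _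
  have b3 : (repSize (solve (parts (parse I.encode))) + 2) ^ e3 ≤ ((V + 2) ^ eb + 2) ^ e3 :=
    Nat.pow_le_pow_left (Nat.add_le_add_right (hfold _ (List.prefix_refl _)) 2) _
  simp only
  omega

end GWMMInstance

/-- As `n ≥ 6`, one has `n + 1 ≤ n ^ 2`, which turns the configuration bound into `k * n ^ (2 * k)`;
the two other summands are absorbed by `2 * n ^ (2 * k + 1)`. Raising the exponent from `e` to `e +
1` pays for the halting step. -/
theorem GWMMInstance.bound_le (I : GWMMInstance) {k n : ℕ} (hn : n = I.encode.length)
    (hk : k = I.machine.states.card + I.machine.inputs.card + I.machine.outputs.card) (e : ℕ) :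
    (n + configBound I.machine n + 2) ^ e + 1 ≤ (k + 2) ^ (e + 1) * n ^
      ((2 * k + 1) * (e + 1)) := by
  have h6 := I.word_length_le_size
  have hn2 : n + 1 ≤ n ^ 2 := by nlinarith
  have h1 : configBound I.machine n ≤ k * n ^ (2 * k) := by
    refine Nat.mul_le_mul (by omega) ?_
    rw [pow_mul]
    exact (Nat.pow_le_pow_left hn2 _).trans (Nat.pow_le_pow_right (Nat.pow_pos (by omega))
      (by omega))
  have h2 : n + configBound I.machine n + 2 ≤ (k + 2) * n ^ (2 * k + 1) := by
    have h3 : n ^ (2 * k) ≤ n ^ (2 * k + 1) := Nat.pow_le_pow_right (by omega) (by omega)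
    have h4 : n ^ 1 ≤ n ^ (2 * k + 1) := Nat.pow_le_pow_right (by omega) (by omega)
    have h5 := Nat.mul_le_mul_left k h3
    rw [pow_one] at h4
    rw [Nat.add_mul]
    omega
  have h7 : (n + configBound I.machine n + 2) ^ e + 1 ≤
      (n + configBound I.machine n + 2) ^ (e + 1) := by
    have : 1 ≤ (n + configBound I.machine n + 2) ^ e := Nat.one_le_pow _ _ (by omega)
    rw [pow_succ]
    nlinarith
  refine h7.trans ((Nat.pow_le_pow_left h2 _).trans (le_of_eq ?_))
  rw [mul_pow, ← pow_mul]

theorem mainTheorem9 :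
    (varGWMM.restrict fun I : GWMMInstance => (none : Letter) ∉ I.machine.inputs).InXP := by
  obtain ⟨c, e, h⟩ := GWMMInstance.exists_prog
  simp only [GWMMInstance.parts_parse_encode] at h
  have hf : Primrec fun k : ℕ => (k + 2) ^ (e + 1) := by
    have (m : ℕ) : Primrec fun k : ℕ => (k + 2) ^ m := by
      induction m with
      | zero => simpa using Primrec.const 1
      | succ m ih =>
        simp only [pow_succ]
        exact Primrec.nat_mul.comp ih (Primrec.nat_add.comp .id (.const 2))
    exact this _
  have hg : Primrec fun k : ℕ => (2 * k + 1) * (e + 1) :=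
    Primrec.nat_mul.comp (Primrec.nat_add.comp (Primrec.nat_mul.comp (.const 2) .id) (.const 1))
      (.const _)
  -- The machine is fixed before the instance is given; `f` and `g` are read off from `bound_le`,
  -- with the exponent `e` of the program as a constant.
  refine ⟨_, _, hf.to_comp, hg.to_comp,
    ⟨c.toFinTM2 Stk.inp Stk.out, Equiv.refl GWMMInstance.Sym, Equiv.refl Bool⟩, ?_⟩
  rintro ⟨I, hI⟩
  refine ⟨_, GWMMInstance.accepts_iff I hI, ?_⟩
  obtain ⟨t, ht, hr⟩ := h I
  have key := StackCmd.outputsInTime hr ((Nat.add_le_add_right ht 1).trans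
    (I.bound_le rfl rfl e))
  have e1 : List.map (Equiv.refl GWMMInstance.Sym).symm I.encode = I.encode := List.map_id _
  refine Eq.mp ?_ key
  congr 2
  exact e1.symm
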